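/- Let $(E;\oplus,0,1)$ be an effect algebra: $\oplus$ is a partial operation which is commutative and associative (in the partial sense), every $a$ has a unique orthosupplement $a'$ with $a\oplus a'=1$, and $a\oplus 1$ is defined only for $a=0$. It is ordered by $a\le b$ iff $a\oplus c=b$ for some $c$, and then $b\ominus a:=c$. It is archimedean if $a=0$ whenever $na=a\oplus\dots\oplus a$ exists for all $n\in\mathbb N$. Elements $a,b$ are Mackey compatible, $a\leftrightarrow b$, if $a=a_1\oplus c$, $b=b_1\oplus c$ for some $a_1,b_1,c$ such that $a_1\oplus b_1\oplus c$ exists. All infima $\wedge$ below are taken in $E$. *Compression bases.* A compression is an additive map $J:E\to E$ such that $a\le J(1)\Rightarrow J(a)=a$, and $J(a)=0\Leftrightarrow a\le J(1)'$. Let $(J_p)_{p\in P}$ be a compression base on $E$: $P\subseteq E$ is a sub-effect algebra (its elements are called projections), each $J_p$ is a compression with $J_p(1)=p$, and whenever $p,q\in P$ and $p\leftrightarrow q$, then $J_p\circ J_q=J_r$ for some $r\in P$. Put $C(p)=\{a: a=J_p(a)\oplus J_{p'}(a)\}$ for $p\in P$; $PC(A)=\{p\in P: A\subseteq C(p)\}$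 and $P(A)=PC(PC(A)\cup A)$ for $A\subseteq E$; $PC(a)=PC(\{a\})$, $P(a)=P(\{a\})$, $P(a,b)=P(\{a,b\})$; and $$P_\le(a,b)=\{p\in P(a,b): J_p(a)\le J_p(b),\ J_{p'}(b)\le J_{p'}(a)\}.$$ $E$ is spectral (with respect to the given base) if * for every $a\in E$ there is a Boolean subalgebra $B\subseteq P$ (a sub-effect algebra which is a Boolean algebra in the induced order) such that for all $p\in P$: $a\in C(p)\Leftrightarrow B\subseteq C(p)$; * $P_\le(a,b)\neq\emptyset$ whenever $p\leftrightarrow q$ for all $p\in P(a)$, $q\in P(b)$; * every $a\in E$ has a projection cover $a^\circ\in P$: for all $q\in P$, $a\le q\Leftrightarrow a^\circ\le q$. *Spectral resolution.* For a binary string $w=w_1\dots w_n$ let $l(w)=n$, $k(w)=\sum_j w_j2^{n-j}$, $\lambda(w)=k(w)/2^{n}$ and $\lambda(w+1)=(k(w)+1)/2^{n}$. Let $(b-a)_+:=J_p(b)\ominus J_p(a)$ for any $p\in P_\le(a,b)$. For $a\in E$ put $c_\varepsilon=a$, $u_\varepsilon=a^\circ$ for the empty string $\varepsilon$ and, recursively,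 $$u_{w0}=\big(((c_w-c_w')_+)^\circ\big)'\wedge u_w,\quad u_{w1}=u_w\wedge u_{w0}',\quad c_{w0}=2J_{u_{w0}}(c_w),\quad c_{w1}=(c_w-c_w')_+\wedge u_w .$$ The binary spectral resolution of $a$ is the family indexed by the dyadic rationals in $[0,1]$ given by $p_{a,0}=(a^\circ)'$, $p_{a,1}=1$ and, for every $w$, $$p_{a,\lambda(w1)}=(a^\circ)'\oplus\bigoplus\{u_v:\ l(v)=l(w)+1,\ v\le w0\}$$ ($\le$ is the lexicographical order). The rational spectral resolution of $a$ is the family $(p_{a,\lambda})_{\lambda\in\mathbb Q\cap[0,1]}$, where $p_{a,\lambda}=\bigwedge\{p_{a,\mu}:\mu>\lambda,\ \mu\in[0,1]\text{ dyadic}\}$ (the empty infimum is $1$). *Doubling maps.* On the effect algebra $[0,u]$, $u\in P$, with orthosupplement $b\mapsto u\ominus b$, let $f_0(b)=2b$ and $f_1(b)=u\ominus 2(u\ominus b)$, each defined iff the double in question exists in $[0,u]$, and let $f_w=f_{w_n}\circ\dots\circ f_{w_1}$ ($f_\varepsilon$ is the identity), defined where all steps are defined. **Theorem.** Let $E$ be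 an archimedean effect algebra that is spectral with respect to a compression base $(J_p)_{p\in P}$, and let $a\in E$. Then the rational spectral resolution of $a$ exists and is uniquely determined, and it is the unique family $(p_\lambda)_{\lambda\in\mathbb Q\cap[0,1]}$ of elements of $E$ such that 1. $p_\lambda\in PC(a)$ for all $\lambda$; 2. $p_0\le a'$, $p_1=1$, and $p_\lambda\le p_\mu$ whenever $\lambda\le\mu$; 3. $p_\lambda=\bigwedge\{p_\mu:\mu>\lambda,\ \mu\in\mathbb Q\cap[0,1]\}$ for all $\lambda$; 4. for every binary string $w$, the infimum $u_w:=p_{\lambda(w+1)}\wedge p_{\lambda(w)}'$ exists and is a projection, and, with $f_w$ formed in the effect algebra $[0,u_w]$, the element $f_w(J_{u_w}(a))$ exists. -/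

import Mathlib

universe v

/-- An effect algebra `(E; ⊕, 0, 1)`. The partial operation `⊕` is `oplus`, and
`oplus a b = some c` means that `a ⊕ b` is defined and equal to `c`. -/
class EffectAlgebra (E : Type v) extends Zero E, One E where
  oplus : E → E → Option E
  oplus_comm : ∀ {a b c : E}, oplus a b = some c → oplus b a = some c
  oplus_assoc : ∀ {a b c d e : E}, oplus a b = some d → oplus d c = some e →
    ∃ f, oplus b c = some f ∧ oplus a f = some e
  existsUnique_ortho : ∀ a : E, ∃! b : E, oplus a b = some 1
  eq_zero_of_oplus_one : ∀ {a b : E}, oplus a 1 = some b → a = 0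

namespace EffectAlgebra

variable {E : Type v} [EffectAlgebra E]

/-- The orthosupplement `a'`, the unique element with `a ⊕ a' = 1`. -/
noncomputable def ortho (a : E) : E := (existsUnique_ortho a).choose

theorem oplus_ortho (a : E) : oplus a (ortho a) = some 1 :=
  (existsUnique_ortho a).choose_spec.1

theorem eq_ortho {a b : E} (h : oplus a b = some 1) : b = ortho a :=
  (existsUnique_ortho a).unique h (oplus_ortho a)

theorem ortho_ortho (a : E) : ortho (ortho a) = a :=
  (eq_ortho (oplus_comm (oplus_ortho a))).symm

theorem one_oplus_zero : oplus (1 : E) 0 = some 1 := by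
  have h := oplus_ortho (1 : E)
  rwa [eq_zero_of_oplus_one (oplus_comm h)] at h

theorem oplus_zero (a : E) : oplus a 0 = some a := by
  have key : ∀ b : E, oplus (ortho b) 0 = some (ortho b) := by
    intro b
    obtain ⟨f, h1, h2⟩ := oplus_assoc (oplus_ortho b) one_oplus_zero
    rwa [eq_ortho h2] at h1
  have h := key (ortho a)
  rwa [ortho_ortho] at h

theorem eq_zero_of_oplus_self {a e : E} (h : oplus a e = some a) : e = 0 := by
  obtain ⟨f, h1, h2⟩ := oplus_assoc (oplus_comm h) (oplus_ortho a)
  rw [oplus_ortho a, Option.some_inj] at h1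
  rw [← h1] at h2
  exact eq_zero_of_oplus_one h2

theorem eq_zero_of_oplus_eq_zero {c d : E} (h : oplus c d = some 0) : c = 0 := by
  obtain ⟨f, h1, _⟩ := oplus_assoc h (oplus_comm one_oplus_zero)
  have hd : d = 0 := eq_zero_of_oplus_one h1
  rw [hd, oplus_zero, Option.some_inj] at h
  exact h

/-- The order of an effect algebra: `a ≤ b` iff `a ⊕ c = b` for some `c`. -/
instance instPartialOrder : PartialOrder E where
  le a b := ∃ c, oplus a c = some b
  le_refl a := ⟨0, oplus_zero a⟩
  le_trans a b c := by
    rintro ⟨x, hx⟩ ⟨y, hy⟩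
    obtain ⟨f, _, h2⟩ := oplus_assoc hx hy
    exact ⟨f, h2⟩
  le_antisymm a b := by
    rintro ⟨x, hx⟩ ⟨y, hy⟩
    obtain ⟨f, h1, h2⟩ := oplus_assoc hx hy
    rw [eq_zero_of_oplus_self h2] at h1
    rw [eq_zero_of_oplus_eq_zero h1, oplus_zero, Option.some_inj] at hx
    exact hx

/-- The multiple `n a`, if it exists. -/
def nmul (a : E) : ℕ → Option E
  | 0 => some 0
  | n + 1 => (nmul a n).bind fun b => oplus b a

/-- The orthosum of a finite list of elements, if it exists. -/
def osum : List E → Option E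
  | [] => some 0
  | x :: l => (osum l).bind fun b => oplus x b

variable (E) in
/-- `E` is archimedean: if `n a` exists for all `n`, then `a = 0`. -/
def IsArchimedean : Prop :=
  ∀ a : E, (∀ n : ℕ, ∃ b, nmul a n = some b) → a = 0

/-- Mackey compatibility. -/
def MackeyCompatible (a b : E) : Prop :=
  ∃ a₁ b₁ c s t : E, oplus a₁ b₁ = some s ∧ oplus s c = some t ∧
    oplus a₁ c = some a ∧ oplus b₁ c = some b

/-- Sub-effect algebras. -/
structure IsSubEffectAlgebra (F : Set E) : Prop where
  zero_mem : (0 : E) ∈ F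
  one_mem : (1 : E) ∈ F
  ortho_mem : ∀ {a : E}, a ∈ F → ortho a ∈ F
  oplus_mem : ∀ {a b c : E}, a ∈ F → b ∈ F → oplus a b = some c → c ∈ F

/-- Additive maps. -/
def IsAdditive (J : E → E) : Prop :=
  ∀ a b c : E, oplus a b = some c → oplus (J a) (J b) = some (J c)

/-- Retractions; the focus of `J` is `J 1`. -/
structure IsRetraction (J : E → E) : Prop where
  additive : IsAdditive J
  apply_eq : ∀ a : E, a ≤ J 1 → J a = a

/-- Compressions. -/
structure IsCompression (J : E → E) : Prop extends IsRetraction J where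
  apply_eq_zero_iff : ∀ a : E, J a = 0 ↔ a ≤ ortho (J 1)

end EffectAlgebra

open EffectAlgebra in
/-- A compression base `(J_p)_{p ∈ P}`. Only the values `J p` with `p ∈ P` matter. -/
structure CompressionBase (E : Type v) [EffectAlgebra E] where
  /-- the set of projections -/
  P : Set E
  /-- the compressions -/
  J : E → E → E
  isSubEffectAlgebra : IsSubEffectAlgebra P
  isCompression : ∀ p ∈ P, IsCompression (J p)
  focus : ∀ p ∈ P, J p 1 = p
  comp : ∀ p ∈ P, ∀ q ∈ P, MackeyCompatible p q → ∃ r ∈ P, J p ∘ J q = J r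

/-- `k(w) = ∑ w_j 2^(l(w) - j)`, the integer with binary digits `w = w_1 … w_n`. -/
def binK (w : List Bool) : ℕ := w.foldl (fun k i => 2 * k + i.toNat) 0

theorem binK_lt (w : List Bool) : binK w < 2 ^ w.length := by
  have key : ∀ (w : List Bool) (k : ℕ),
      w.foldl (fun k i => 2 * k + i.toNat) k < (k + 1) * 2 ^ w.length := by
    intro w
    induction w with
    | nil => intro k; simp
    | cons i w ih =>
      intro k
      refine (ih (2 * k + i.toNat)).trans_le ?_
      rw [List.length_cons, pow_succ', ← mul_assoc]
      refine Nat.mul_le_mul_right _ ?_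
      have := Bool.toNat_le i
      omega
  simpa [binK] using key w 0

/-- `λ(w) = k(w) / 2^l(w)`. -/
def binVal (w : List Bool) : Set.Icc (0 : ℚ) 1 :=
  ⟨(binK w : ℚ) / 2 ^ w.length, by positivity, by
    rw [div_le_one (by positivity)]
    exact_mod_cast (binK_lt w).le⟩

/-- `λ(w + 1) = (k(w) + 1) / 2^l(w)`: the value of the next string of the same length, and `1` if
`w` is a string of ones. -/
def binValSucc (w : List Bool) : Set.Icc (0 : ℚ) 1 :=
  ⟨((binK w : ℚ) + 1) / 2 ^ w.length, by positivity, by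
    rw [div_le_one (by positivity)]
    exact_mod_cast (binK_lt w)⟩

/-- All binary strings of length `n`, in lexicographical order. -/
def binStrings : ℕ → List (List Bool)
  | 0 => [[]]
  | n + 1 => (binStrings n).map (List.cons false) ++ (binStrings n).map (List.cons true)

/-- The dyadic rationals in `[0, 1]`. -/
def IsDyadic (μ : Set.Icc (0 : ℚ) 1) : Prop := ∃ k n : ℕ, (μ : ℚ) = k / 2 ^ n

namespace CompressionBase

open EffectAlgebra

variable {E : Type v} [EffectAlgebra E] (cb : CompressionBase E)

/-- The commutant `C(p)` of a projection `p`. -/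
def commutant (p : E) : Set E := {a | oplus (cb.J p a) (cb.J (ortho p) a) = some a}

/-- `PC(A)`: the projections commuting with all elements of `A`. -/
def PC (A : Set E) : Set E := {p | p ∈ cb.P ∧ ∀ a ∈ A, a ∈ cb.commutant p}

/-- The bicommutant `P(A) = PC(PC(A) ∪ A)`. -/
def bicommutant (A : Set E) : Set E := cb.PC (cb.PC A ∪ A)

/-- `p` is the projection cover of `a`. -/
def IsProjectionCover (a p : E) : Prop := p ∈ cb.P ∧ ∀ q ∈ cb.P, a ≤ q ↔ p ≤ q

/-- The projection cover property. -/
def ProjectionCoverProperty : Prop := ∀ a : E, ∃ p, cb.IsProjectionCover a p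

/-- Boolean subalgebras of `P`: sub-effect algebras of `P` that are Boolean algebras in the
induced order. -/
def IsBooleanSubalgebra (B : Set E) : Prop :=
  B ⊆ cb.P ∧ IsSubEffectAlgebra B ∧
    ∃ inst : BooleanAlgebra B, ∀ x y : B, inst.le x y ↔ (x : E) ≤ (y : E)

/-- `E` has the b-property. -/
def BProperty : Prop :=
  ∀ a : E, ∃ B : Set E, cb.IsBooleanSubalgebra B ∧
    ∀ p ∈ cb.P, a ∈ cb.commutant p ↔ B ⊆ cb.commutant p

/-- `e C f`: all elements of `P(e)` are Mackey compatible with all elements of `P(f)`. -/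
def Commute (e f : E) : Prop :=
  ∀ p ∈ cb.bicommutant {e}, ∀ q ∈ cb.bicommutant {f}, MackeyCompatible p q

/-- The set `P_≤(e, f)`. -/
def PLe (e f : E) : Set E :=
  {p | p ∈ cb.bicommutant {e, f} ∧ cb.J p e ≤ cb.J p f ∧
    cb.J (ortho p) f ≤ cb.J (ortho p) e}

/-- The b-comparability property. -/
structure BComparability : Prop where
  bProperty : cb.BProperty
  nonempty_PLe : ∀ e f : E, cb.Commute e f → (cb.PLe e f).Nonempty

/-- `E` is spectral with respect to the compression base. -/
structure IsSpectral : Prop where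
  bComparability : cb.BComparability
  projectionCoverProperty : cb.ProjectionCoverProperty

/-- `x = (b - a)_+`, that is, `x = J_p(b) ⊖ J_p(a)` with `p ∈ P_≤(a, b)`. -/
def IsPosPart (b a x : E) : Prop :=
  ∃ p ∈ cb.PLe a b, oplus (cb.J p a) x = some (cb.J p b)

/-- The splitting of `c` in `[0, u]`: with `x = (c - c')_+` and `r` the projection cover of `x`,
`u₀ = r' ∧ u`, `u₁ = u ∧ u₀'`, `c₀ = 2 J_{u₀}(c)` and `c₁ = x ∧ u`. -/
def IsSplitting (u c u₀ u₁ c₀ c₁ : E) : Prop :=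
  ∃ x r : E, cb.IsPosPart c (ortho c) x ∧ cb.IsProjectionCover x r ∧
    IsGLB {ortho r, u} u₀ ∧ IsGLB {u, ortho u₀} u₁ ∧
    oplus (cb.J u₀ c) (cb.J u₀ c) = some c₀ ∧ IsGLB {x, u} c₁

/-- The families `u_w`, `c_w` obtained from `a` by iterated splitting. -/
structure IsSplittingFamily (a : E) (u c : List Bool → E) : Prop where
  c_nil : c [] = a
  u_nil : cb.IsProjectionCover a (u [])
  split : ∀ w : List Bool, cb.IsSplitting (u w) (c w)
    (u (w ++ [false])) (u (w ++ [true])) (c (w ++ [false])) (c (w ++ [true]))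

/-- `p` is the binary spectral resolution of `a`, a family indexed by the dyadic rationals in
`[0, 1]`: `p_0 = (a°)'`, `p_1 = 1` and
`p_{λ(w1)} = (a°)' ⊕ ⨁ {u_v | l(v) = l(w) + 1, v ≤ w0}`. For strings of the same length, the
lexicographical order is the order of the numbers `k(w)`. -/
def IsBinarySpectralResolution (a : E) (p : {μ : Set.Icc (0 : ℚ) 1 // IsDyadic μ} → E) : Prop :=
  ∃ u c : List Bool → E, cb.IsSplittingFamily a u c ∧
    (∀ μ, μ.1 = 0 → p μ = ortho (u [])) ∧
    (∀ μ, μ.1 = 1 → p μ = 1) ∧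
    ∀ (w : List Bool) (μ), μ.1 = binVal (w ++ [true]) →
      osum (ortho (u []) ::
        ((binStrings (w.length + 1)).filter
          (fun v => binK v ≤ binK (w ++ [false]))).map u) = some (p μ)

/-- `p` is the rational spectral resolution of `a`: `p_λ` is the infimum of the `q_μ` with
`μ > λ` dyadic, where `q` is the binary spectral resolution of `a`. -/
def IsRationalSpectralResolution (a : E) (p : Set.Icc (0 : ℚ) 1 → E) : Prop :=
  ∃ q, cb.IsBinarySpectralResolution a q ∧
    ∀ l : Set.Icc (0 : ℚ) 1, IsGLB {x | ∃ μ, l < μ.1 ∧ x = q μ} (p l)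

end CompressionBase

namespace EffectAlgebra

variable {E : Type v} [EffectAlgebra E]

/-- `d = f_i(b)` in the effect algebra `[0, u]`, where `f_0(b) = 2b` and `f_1(b) = (2b')'`, with
the orthosupplement `b' = u ⊖ b` of `[0, u]`. -/
def IsDoubling (u : E) : Bool → E → E → Prop
  | false, b, d => oplus b b = some d ∧ d ≤ u
  | true, b, d => ∃ b' e : E, oplus b b' = some u ∧ oplus b' b' = some e ∧ oplus e d = some u

/-- `d = f_w(b)` in `[0, u]`, where `f_w = f_{w_n} ∘ ⋯ ∘ f_{w_1}` for `w = w_1 … w_n`. -/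
def IsIteratedDoubling (u : E) : List Bool → E → E → Prop
  | [], b, d => d = b
  | i :: w, b, d => ∃ e : E, IsDoubling u i b e ∧ IsIteratedDoubling u w e d

end EffectAlgebra

open EffectAlgebra in
/-- The four conditions on a family `p` indexed by `ℚ ∩ [0, 1]`. -/
structure CompressionBase.SpectralConditions {E : Type v} [EffectAlgebra E]
    (cb : CompressionBase E) (a : E) (p : Set.Icc (0 : ℚ) 1 → E) : Prop where
  mem_PC : ∀ l, p l ∈ cb.PC {a}
  zero_le : p 0 ≤ ortho a
  one_eq : p 1 = 1
  mono : ∀ l m, l ≤ m → p l ≤ p m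
  right_continuous : ∀ l, IsGLB {x | ∃ m, l < m ∧ x = p m} (p l)
  doubling : ∀ w : List Bool, ∃ u ∈ cb.P,
    IsGLB {p (binValSucc w), ortho (p (binVal w))} u ∧
    ∃ d, IsIteratedDoubling u w (cb.J u a) d

/-! Call a projection r a piece over w if f_w(J_r(a)) exists in [0, r]; this expresses that on r the
element a lies between λ(w) and λ(w+1). Everything rests on one description: p_{a,λ} is the largest
projection orthogonal to every piece r over some w with λ(w) > λ, where r ranges over the double
commutant of a (`IsCut`). Such a projection is unique, and right continuity follows by replacing a
lower bound in E by its projection cover (`isGLB_of_isCut`).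

The engine is `eq_zero_of_isIteratedDoubling`: a piece over both v and w with λ(v+1) < λ(w) is zero,
so compatible pieces over separated intervals are orthogonal. Compatibility is supplied by the
b-property, which makes the projections in the double commutant commute with a and with one another.

At dyadic points the cuts are the partial sums of the projections u_w (`IsTree.isCut`). Their
maximality is where archimedeanity enters: if g is orthogonal to all pieces above λ(w), then
J_g(c_w) can be doubled forever, so it vanishes, and with it J_g(u_w).

At other rationals the defining infimum runs over an infinite family and need not exist a priori.
There the cut is built by descending the Stern–Brocot tree (`IsFrame`): a piece on which a lies
between Farey neighbours α/β and γ/δ is split at the mediant by comparing e = βa ⊖ αu with f = γu ⊖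
δa. After finitely many splittings k/n is an endpoint, so the cut is a finite sum of projections.
Frames with large denominators fit into dyadic intervals, which ties them back to doublings.

For uniqueness, conditions 1, 2 and 4 make p_m, at dyadic m, a telescoping sum of pieces. With R the
family of cuts, this gives p_m ≤ R_m, and R_l ≤ p_m for dyadic l < m. The gap is needed because
neighbouring pieces may both carry the common endpoint as a value; right continuity closes it. -/

namespace EffectAlgebra

/-! ### Partial sums in a total commutative monoid. -/

variable {E : Type v} [EffectAlgebra E]

set_option linter.unusedSectionVars false

/-- `Option E` with the orthosum extended by making the undefined value absorbing. -/
def PSum (E : Type v) : Type v := Option E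

/-- The undefined value. -/
def undef : PSum E := (none : Option E)

/-- The embedding of `E` into `PSum E`. -/
def emb (a : E) : PSum E := some a

theorem emb_injective {a b : E} (h : emb a = emb b) : a = b := Option.some_inj.1 h

instance : Zero (PSum E) := ⟨emb 0⟩

instance : Add (PSum E) := ⟨fun x y => Option.bind x fun a => Option.bind y fun b => oplus a b⟩

theorem emb_zero : emb (0 : E) = 0 := rfl

theorem oplus_eq_some_iff {a b c : E} : oplus a b = some c ↔ emb a + emb b = emb c := Iff.rfl

theorem oplus_comm' (a b : E) : oplus a b = oplus b a := by
  apply Option.ext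
  intro c
  exact ⟨fun h => oplus_comm h, fun h => oplus_comm h⟩

theorem add_undef (x : PSum E) : x + undef = undef := by
  rcases x with _ | a <;> rfl

theorem psum_add_comm (x y : PSum E) : x + y = y + x := by
  rcases x with _ | a
  · exact (add_undef y).symm
  rcases y with _ | b
  · rfl
  exact oplus_comm' a b

theorem oplus_bind_assoc (a b c : E) :
    ((oplus a b).bind fun d => oplus d c) = (oplus b c).bind fun f => oplus a f := by
  apply Option.ext
  intro e
  constructor
  · intro h
    obtain ⟨d, hd, he⟩ := Option.bind_eq_some_iff.1 h
    obtain ⟨f, h1, h2⟩ := oplus_assoc hd he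
    exact Option.bind_eq_some_iff.2 ⟨f, h1, h2⟩
  · intro h
    obtain ⟨f, hf, he⟩ := Option.bind_eq_some_iff.1 h
    obtain ⟨g, h1, h2⟩ := oplus_assoc (oplus_comm hf) (oplus_comm he)
    exact Option.bind_eq_some_iff.2 ⟨g, oplus_comm h1, oplus_comm h2⟩

theorem psum_add_assoc (x y z : PSum E) : x + y + z = x + (y + z) := by
  rcases x with _ | a
  · rfl
  rcases y with _ | b
  · rfl
  rcases z with _ | c
  · exact add_undef _
  exact oplus_bind_assoc a b c

theorem psum_add_zero (x : PSum E) : x + 0 = x := by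
  rcases x with _ | a
  · rfl
  · exact oplus_zero a

instance : AddCommMonoid (PSum E) where
  add_assoc := psum_add_assoc
  zero_add x := by rw [psum_add_comm, psum_add_zero]
  add_zero := psum_add_zero
  add_comm := psum_add_comm
  nsmul := nsmulRec

/-- The standard source of existence: to see that a sum is defined, exhibit it as part of a sum
already known to be defined. -/
theorem exists_emb_left {x y : PSum E} {c : E} (h : x + y = emb c) : ∃ a, x = emb a := by
  rcases x with _ | a
  · exact absurd h.symm (Option.some_ne_none c)
  · exact ⟨a, rfl⟩

theorem exists_emb_right {x y : PSum E} {c : E} (h : x + y = emb c) : ∃ b, y = emb b :=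
  exists_emb_left ((add_comm y x).trans h)

theorem emb_add_ortho (a : E) : emb a + emb (ortho a) = emb 1 := oplus_ortho a

theorem add_left_cancel_of_emb {x y z : PSum E} {d : E} (h : x + y = emb d) (h' : x + z = emb d) :
    y = z := by
  obtain ⟨b, rfl⟩ := exists_emb_right h
  obtain ⟨c, rfl⟩ := exists_emb_right h'
  -- Both candidates are orthosupplements of the same element x ⊕ d'.
  have h1 : emb b + (x + emb (ortho d)) = emb 1 := by
    rw [← emb_add_ortho d, ← h]; abel
  have h2 : emb c + (x + emb (ortho d)) = emb 1 := by
    rw [← emb_add_ortho d, ← h']; abel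
  obtain ⟨s, hs⟩ := exists_emb_right h1
  rw [hs, add_comm] at h1 h2
  rw [eq_ortho h1, eq_ortho h2]

theorem le_iff_emb {a b : E} : a ≤ b ↔ ∃ c, emb a + emb c = emb b := Iff.rfl

theorem le_of_add {a b : E} {x : PSum E} (h : emb a + x = emb b) : a ≤ b := by
  obtain ⟨c, rfl⟩ := exists_emb_right h
  exact ⟨c, h⟩

theorem le_of_add' {a b : E} {x : PSum E} (h : x + emb a = emb b) : a ≤ b :=
  le_of_add ((add_comm _ _).trans h)

theorem ea_zero_le (a : E) : (0 : E) ≤ a := ⟨a, oplus_comm (oplus_zero a)⟩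

theorem ea_le_one (a : E) : a ≤ 1 := ⟨_, oplus_ortho a⟩

theorem eq_zero_of_le_zero {a : E} (h : a ≤ 0) : a = 0 := le_antisymm h (ea_zero_le a)

theorem ortho_one : ortho (1 : E) = 0 := (eq_ortho one_oplus_zero).symm

theorem ortho_zero : ortho (0 : E) = 1 := (eq_ortho (oplus_comm one_oplus_zero)).symm

theorem ortho_anti {a b : E} (h : a ≤ b) : ortho b ≤ ortho a := by
  obtain ⟨c, hc⟩ := le_iff_emb.1 h
  have h1 : emb a + (emb c + emb (ortho b)) = emb 1 := by
    rw [← add_assoc, hc, emb_add_ortho]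
  obtain ⟨s, hs⟩ := exists_emb_right h1
  rw [hs] at h1
  rw [← eq_ortho h1]
  exact le_of_add' hs

theorem le_ortho_comm {a b : E} : a ≤ ortho b ↔ b ≤ ortho a := by
  constructor <;> intro h <;> simpa only [ortho_ortho] using ortho_anti h

theorem ortho_le_ortho {a b : E} : ortho a ≤ ortho b ↔ b ≤ a := by
  rw [le_ortho_comm, ortho_ortho]

theorem le_ortho_of_add {a b c : E} (h : emb a + emb b = emb c) : a ≤ ortho b := by
  have h1 : emb b + (emb a + emb (ortho c)) = emb 1 := by
    rw [← emb_add_ortho c, ← h]; abel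
  obtain ⟨s, hs⟩ := exists_emb_right h1
  rw [hs] at h1
  rw [← eq_ortho h1]
  exact le_of_add hs

theorem exists_add_of_le_ortho {a b : E} (h : a ≤ ortho b) : ∃ c, emb a + emb b = emb c := by
  obtain ⟨d, hd⟩ := le_iff_emb.1 h
  apply exists_emb_left (y := emb d) (c := 1)
  rw [← emb_add_ortho b, ← hd]
  abel

/-- If `u ⊖ r = s` then `u' ⊕ r = s'`. -/
theorem ortho_add_of_add {r s u : E} (h : emb r + emb s = emb u) :
    emb (ortho u) + emb r = emb (ortho s) := by
  have h1 : emb s + (emb (ortho u) + emb r) = emb 1 := by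
    rw [← emb_add_ortho u, ← h]; abel
  obtain ⟨t, ht⟩ := exists_emb_right h1
  rw [ht] at h1 ⊢
  rw [← eq_ortho h1]

theorem eq_zero_of_add_eq_zero {a : E} {x : PSum E} (h : emb a + x = emb 0) : a = 0 := by
  obtain ⟨b, rfl⟩ := exists_emb_right h
  exact eq_zero_of_oplus_eq_zero h

theorem nmul_eq (a : E) (n : ℕ) : nmul a n = n • emb a := by
  induction n with
  | zero => rw [zero_smul]; rfl
  | succ n ih =>
    rw [succ_nsmul, ← ih]
    cases h : nmul a n <;> simp only [nmul, h] <;> rfl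

theorem osum_eq (l : List E) : osum l = (l.map emb).sum := by
  induction l with
  | nil => rfl
  | cons x l ih =>
    rw [List.map_cons, List.sum_cons, ← ih]
    cases h : osum l <;> simp only [osum, h] <;> rfl

theorem IsArchimedean.eq_zero (h : IsArchimedean E) {a : E} (H : ∀ n : ℕ, ∃ b, n • emb a = emb b) :
    a = 0 :=
  h a fun n => (H n).imp fun _ hb => (nmul_eq a n).trans hb

theorem exists_nsmul_of_le {x : PSum E} {m n : ℕ} (h : m ≤ n) {b : E}
    (hb : n • x = emb b) :
    ∃ c, m • x = emb c := by
  rw [← Nat.add_sub_cancel' h, add_smul] at hb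
  exact exists_emb_left hb

/-- The action of a map on `PSum E`. -/
def pmap (J : E → E) (x : PSum E) : PSum E := Option.map J x

theorem pmap_emb (J : E → E) (a : E) : pmap J (emb a) = emb (J a) := rfl

namespace IsAdditive

variable {J : E → E} (hJ : IsAdditive J)
include hJ

theorem emb_add {a b c : E} (h : emb a + emb b = emb c) : emb (J a) + emb (J b) = emb (J c) :=
  hJ a b c h

theorem map_zero : J 0 = 0 := by
  have h := hJ.emb_add (add_zero (emb (0 : E)))
  exact eq_zero_of_oplus_self h

theorem pmap_add {x y : PSum E} {c : E} (h : x + y = emb c) :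
    pmap J x + pmap J y = emb (J c) := by
  obtain ⟨a, rfl⟩ := exists_emb_left h
  obtain ⟨b, rfl⟩ := exists_emb_right h
  exact hJ.emb_add h

theorem pmap_nsmul {x : PSum E} (n : ℕ) {c : E} (h : n • x = emb c) :
    n • pmap J x = emb (J c) := by
  induction n generalizing c with
  | zero =>
    rw [zero_smul] at h ⊢
    rw [← emb_injective h, hJ.map_zero, emb_zero]
  | succ n ih =>
    rw [succ_nsmul] at h ⊢
    obtain ⟨b, hb⟩ := exists_emb_left h
    rw [ih hb, ← hJ.pmap_add h, hb, pmap_emb]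

theorem pmap_comb {m n : ℕ} {e f c : E} (h : m • emb e + n • emb f = emb c) :
    m • emb (J e) + n • emb (J f) = emb (J c) := by
  obtain ⟨a, ha⟩ := exists_emb_left h
  obtain ⟨b, hb⟩ := exists_emb_right h
  rw [← pmap_emb, ← pmap_emb, hJ.pmap_nsmul _ ha, hJ.pmap_nsmul _ hb, ← hJ.pmap_add h, ha, hb,
    pmap_emb, pmap_emb]

theorem monotone {a b : E} (h : a ≤ b) : J a ≤ J b := by
  obtain ⟨c, hc⟩ := le_iff_emb.1 h
  exact le_of_add (hJ.emb_add hc)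

end IsAdditive

end EffectAlgebra

/-! ### Compressions, commutants and projection covers. -/

namespace EffectAlgebra

theorem IsSubEffectAlgebra.sub_mem {E : Type v} [EffectAlgebra E] {F : Set E}
    (hF : IsSubEffectAlgebra F) {p s r : E} (hp : p ∈ F) (hr : r ∈ F)
    (h : emb p + emb s = emb r) : s ∈ F := by
  have h1 := hF.ortho_mem (hF.oplus_mem (hF.ortho_mem hr) hp (ortho_add_of_add h))
  rwa [ortho_ortho] at h1

end EffectAlgebra

namespace CompressionBase

open EffectAlgebra

variable {E : Type v} [EffectAlgebra E] (cb : CompressionBase E)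

set_option linter.unusedSectionVars false

theorem isAdditive {p : E} (hp : p ∈ cb.P) : IsAdditive (cb.J p) := (cb.isCompression p hp).additive

theorem ortho_mem {p : E} (hp : p ∈ cb.P) : ortho p ∈ cb.P := cb.isSubEffectAlgebra.ortho_mem hp

theorem add_mem {p q r : E} (hp : p ∈ cb.P) (hq : q ∈ cb.P) (h : emb p + emb q = emb r) :
    r ∈ cb.P := cb.isSubEffectAlgebra.oplus_mem hp hq h

theorem one_mem : (1 : E) ∈ cb.P := cb.isSubEffectAlgebra.one_mem

theorem sub_mem {p s r : E} (hp : p ∈ cb.P) (hr : r ∈ cb.P) (h : emb p + emb s = emb r) :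
    s ∈ cb.P := cb.isSubEffectAlgebra.sub_mem hp hr h

section

variable {cb}

theorem J_add {p a b c : E} (hp : p ∈ cb.P) (h : emb a + emb b = emb c) :
    emb (cb.J p a) + emb (cb.J p b) = emb (cb.J p c) := (cb.isAdditive hp).emb_add h

theorem J_mono {p a b : E} (hp : p ∈ cb.P) (h : a ≤ b) : cb.J p a ≤ cb.J p b :=
  (cb.isAdditive hp).monotone h

theorem J_zero {p : E} (hp : p ∈ cb.P) : cb.J p 0 = 0 := (cb.isAdditive hp).map_zero

theorem J_le {p : E} (hp : p ∈ cb.P) (a : E) : cb.J p a ≤ p := by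
  have h := J_mono hp (ea_le_one a)
  rwa [cb.focus p hp] at h

theorem J_eq_self {p a : E} (hp : p ∈ cb.P) (h : a ≤ p) : cb.J p a = a :=
  (cb.isCompression p hp).apply_eq a (by rwa [cb.focus p hp])

theorem J_eq_zero_iff {p a : E} (hp : p ∈ cb.P) : cb.J p a = 0 ↔ a ≤ ortho p := by
  have h := (cb.isCompression p hp).apply_eq_zero_iff a
  rwa [cb.focus p hp] at h

theorem J_ortho_eq_zero_iff {p a : E} (hp : p ∈ cb.P) : cb.J (ortho p) a = 0 ↔ a ≤ p := by
  rw [J_eq_zero_iff (cb.ortho_mem hp), ortho_ortho]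

theorem J_eq_zero_comm {p q : E} (hp : p ∈ cb.P) (hq : q ∈ cb.P) :
    cb.J p q = 0 ↔ cb.J q p = 0 := by
  rw [J_eq_zero_iff hp, J_eq_zero_iff hq, le_ortho_comm]

theorem J_eq_zero_of_add {p a b c : E} (hp : p ∈ cb.P) (h : emb a + emb b = emb c)
    (ha : cb.J p a = 0) (hb : cb.J p b = 0) : cb.J p c = 0 := by
  have h1 := J_add hp h
  rw [ha, hb, emb_zero, add_zero] at h1
  exact (emb_injective h1).symm

theorem J_eq_zero_of_le {p a b : E} (hp : p ∈ cb.P) (h : a ≤ b) (hb : cb.J p b = 0) :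
    cb.J p a = 0 :=
  eq_zero_of_le_zero (hb ▸ J_mono hp h)

/-- Lying below p means being annihilated by J_{p'}, which is additive; so projections are principal
elements. -/
theorem le_of_add_le {p a b c : E} (hp : p ∈ cb.P) (h : emb a + emb b = emb c)
    (ha : a ≤ p) (hb : b ≤ p) : c ≤ p := by
  rw [← J_ortho_eq_zero_iff hp] at ha hb ⊢
  exact J_eq_zero_of_add (cb.ortho_mem hp) h ha hb

theorem mem_commutant_iff {p a : E} :
    a ∈ cb.commutant p ↔ emb (cb.J p a) + emb (cb.J (ortho p) a) = emb a := Iff.rfl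

theorem J_eq_of_add {p a b c : E} (hp : p ∈ cb.P) (h : emb b + emb c = emb a) (hb : b ≤ p)
    (hc : c ≤ ortho p) : cb.J p a = b ∧ cb.J (ortho p) a = c := by
  have h1 := J_add hp h
  have h2 := J_add (cb.ortho_mem hp) h
  rw [(J_eq_zero_iff hp).2 hc, J_eq_self hp hb, emb_zero, add_zero] at h1
  rw [(J_ortho_eq_zero_iff hp).2 hb, J_eq_self (cb.ortho_mem hp) hc, emb_zero, zero_add] at h2
  exact ⟨(emb_injective h1).symm, (emb_injective h2).symm⟩

theorem mem_commutant_of_add {p a b c : E} (hp : p ∈ cb.P) (h : emb b + emb c = emb a)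
    (hb : b ≤ p) (hc : c ≤ ortho p) : a ∈ cb.commutant p := by
  obtain ⟨h1, h2⟩ := J_eq_of_add hp h hb hc
  rwa [mem_commutant_iff, h1, h2]

/-- The remainder a ⊖ J_p(a) is annihilated by J_p, hence lies below p'. -/
theorem mem_commutant_of_J_le {p a : E} (hp : p ∈ cb.P) (h : cb.J p a ≤ a) :
    a ∈ cb.commutant p := by
  obtain ⟨z, hz⟩ := le_iff_emb.1 h
  refine mem_commutant_of_add hp hz (J_le hp a) ?_
  have h1 := J_add hp hz
  rw [J_eq_self hp (J_le hp a)] at h1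
  rw [← J_eq_zero_iff hp]
  exact eq_zero_of_oplus_self h1

theorem J_le_self {p a : E} (h : a ∈ cb.commutant p) : cb.J p a ≤ a :=
  le_of_add (mem_commutant_iff.1 h)

theorem mem_commutant_ortho {p a : E} (h : a ∈ cb.commutant p) : a ∈ cb.commutant (ortho p) := by
  rw [mem_commutant_iff] at h ⊢
  rw [ortho_ortho, add_comm, h]

theorem mem_commutant_of_le {p a : E} (hp : p ∈ cb.P) (h : a ≤ p) : a ∈ cb.commutant p :=
  mem_commutant_of_J_le hp (J_eq_self hp h).le

theorem commutant_add {p a b c : E} (hp : p ∈ cb.P) (ha : a ∈ cb.commutant p)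
    (hb : b ∈ cb.commutant p) (h : emb a + emb b = emb c) : c ∈ cb.commutant p := by
  rw [mem_commutant_iff] at ha hb ⊢
  rw [← J_add hp h, ← J_add (cb.ortho_mem hp) h, ← h, ← ha, ← hb]
  abel

theorem commutant_sub {p a b c : E} (hp : p ∈ cb.P) (ha : a ∈ cb.commutant p)
    (hc : c ∈ cb.commutant p) (h : emb a + emb b = emb c) : b ∈ cb.commutant p := by
  rw [mem_commutant_iff] at ha hc
  have h1 : emb a + (emb (cb.J p b) + emb (cb.J (ortho p) b)) = emb c := by
    rw [← hc, ← J_add hp h, ← J_add (cb.ortho_mem hp) h]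
    nth_rewrite 1 [← ha]
    abel
  exact add_left_cancel_of_emb h1 h

theorem one_mem_commutant {p : E} (hp : p ∈ cb.P) : (1 : E) ∈ cb.commutant p := by
  rw [mem_commutant_iff, cb.focus p hp, cb.focus _ (cb.ortho_mem hp), emb_add_ortho]

theorem ortho_mem_commutant {p a : E} (hp : p ∈ cb.P) (ha : a ∈ cb.commutant p) :
    ortho a ∈ cb.commutant p :=
  commutant_sub hp ha (one_mem_commutant hp) (emb_add_ortho a)

theorem mackeyCompatible_symm {a b : E} (h : MackeyCompatible a b) : MackeyCompatible b a := by
  obtain ⟨a₁, b₁, c, s, t, h1, h2, h3, h4⟩ := h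
  exact ⟨b₁, a₁, c, s, t, oplus_comm h1, h2, h4, h3⟩

theorem mackeyCompatible_iff {a p : E} (hp : p ∈ cb.P) :
    MackeyCompatible a p ↔ a ∈ cb.commutant p := by
  constructor
  · rintro ⟨a₁, b₁, c, s, t, h1, h2, h3, h4⟩
    rw [oplus_eq_some_iff] at h1 h2 h3 h4
    have h5 : emb a₁ + emb p = emb t := by rw [← h2, ← h1, ← h4]; abel
    rw [add_comm] at h3
    exact mem_commutant_of_add hp h3 (le_of_add' h4) (le_ortho_of_add h5)
  · intro h
    have h1 : emb (cb.J p a) + emb (cb.J (ortho p) a) = emb a := h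
    obtain ⟨q, hq⟩ := le_iff_emb.1 (J_le hp a)
    obtain ⟨t, ht⟩ := exists_add_of_le_ortho (J_le (cb.ortho_mem hp) a)
    have h2 : emb (cb.J (ortho p) a) + emb q + emb (cb.J p a) = emb t := by
      rw [← ht, ← hq]; abel
    obtain ⟨s, hs⟩ := exists_emb_left h2
    refine ⟨cb.J (ortho p) a, q, cb.J p a, s, t, hs, ?_, ?_, ?_⟩
    · rw [oplus_eq_some_iff, ← hs, h2]
    · rw [oplus_eq_some_iff, ← h1, add_comm]
    · rw [oplus_eq_some_iff, ← hq, add_comm]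

theorem commutant_symm {p q : E} (hp : p ∈ cb.P) (hq : q ∈ cb.P) (h : p ∈ cb.commutant q) :
    q ∈ cb.commutant p :=
  (mackeyCompatible_iff hp).1 (mackeyCompatible_symm ((mackeyCompatible_iff hq).2 h))

theorem J_comm_of_mem {p q : E} (hp : p ∈ cb.P) (hq : q ∈ cb.P) (h : p ∈ cb.commutant q) :
    cb.J p q = cb.J q p := by
  have h1 : cb.J q p ≤ p := J_le_self h
  have h2 : cb.J p q ≤ q := J_le_self (commutant_symm hp hq h)
  apply le_antisymm
  · rw [← J_eq_self hq h2]
    exact J_mono hq (J_le hp q)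
  · rw [← J_eq_self hp h1]
    exact J_mono hp (J_le hq p)

/-- The focus of the composite compression is read off by evaluating at 1. -/
theorem J_J {p q : E} (hp : p ∈ cb.P) (hq : q ∈ cb.P) (h : p ∈ cb.commutant q) :
    cb.J p q ∈ cb.P ∧ ∀ a, cb.J p (cb.J q a) = cb.J (cb.J p q) a := by
  obtain ⟨r, hr, hJ⟩ := cb.comp p hp q hq ((mackeyCompatible_iff hq).2 h)
  have h1 : cb.J p q = r := by
    have h2 := congrFun hJ 1
    rwa [Function.comp_apply, cb.focus q hq, cb.focus r hr] at h2
  rw [h1]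
  exact ⟨hr, fun a => congrFun hJ a⟩

theorem J_J_comm {p q : E} (hp : p ∈ cb.P) (hq : q ∈ cb.P) (h : p ∈ cb.commutant q) (a : E) :
    cb.J p (cb.J q a) = cb.J q (cb.J p a) := by
  rw [(J_J hp hq h).2, (J_J hq hp (commutant_symm hp hq h)).2, J_comm_of_mem hp hq h]

theorem J_J_of_le {p q : E} (hp : p ∈ cb.P) (hq : q ∈ cb.P) (h : p ≤ q) (a : E) :
    cb.J p (cb.J q a) = cb.J p a := by
  rw [J_J_comm hp hq (mem_commutant_of_le hq h), J_eq_self hq ((J_le hp a).trans h)]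

theorem J_mem_commutant {p q a : E} (hp : p ∈ cb.P) (hq : q ∈ cb.P) (h : p ∈ cb.commutant q)
    (ha : a ∈ cb.commutant q) : cb.J p a ∈ cb.commutant q := by
  rw [mem_commutant_iff] at ha ⊢
  rw [← J_J_comm hp hq h, ← J_J_comm hp (cb.ortho_mem hq) (mem_commutant_ortho h)]
  exact J_add hp ha

/-- `J_p ⊕ J_s = J_r` on the commutant of `p`, where `p ⊕ s = r`. -/
theorem J_add_J {p s r a : E} (hp : p ∈ cb.P) (hr : r ∈ cb.P) (h : emb p + emb s = emb r)
    (ha : a ∈ cb.commutant p) : emb (cb.J p a) + emb (cb.J s a) = emb (cb.J r a) := by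
  have hpr : p ≤ r := le_of_add h
  have h1 := J_add hr ha
  have h2 := J_add hr (emb_add_ortho p)
  rw [J_eq_self hr hpr, cb.focus r hr] at h2
  have hs : cb.J r (ortho p) = s := emb_injective (add_left_cancel_of_emb h2 h)
  have hrp : r ∈ cb.commutant (ortho p) :=
    mem_commutant_ortho (commutant_symm hp hr (mem_commutant_of_le hr hpr))
  rwa [(J_J hr (cb.ortho_mem hp) hrp).2, hs, J_eq_self hr ((J_le hp a).trans hpr)] at h1

/-- A lower bound y satisfies y = J_{r'}(y) ≤ J_{r'}(u) = s. This identifies the infima in the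
splitting and in condition 4 with differences. -/
theorem isGLB_of_add {r s u : E} (hr : r ∈ cb.P) (h : emb r + emb s = emb u) :
    IsGLB {ortho r, u} s := by
  have hsr : s ≤ ortho r := le_ortho_of_add ((add_comm _ _).trans h)
  constructor
  · rintro y (rfl | rfl)
    · exact hsr
    · exact le_of_add' h
  · intro y hy
    have h1 : y ≤ ortho r := hy (Or.inl rfl)
    have h2 : y ≤ u := hy (Or.inr rfl)
    rw [← J_eq_self (cb.ortho_mem hr) h1, ← (J_eq_of_add hr h le_rfl hsr).2]
    exact J_mono (cb.ortho_mem hr) h2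

theorem isGLB_pair_of_le {x u : E} (h : x ≤ u) : IsGLB {x, u} x := by
  constructor
  · rintro y (rfl | rfl)
    exacts [le_rfl, h]
  · intro y hy
    exact hy (Or.inl rfl)

theorem IsProjectionCover.le {a c : E} (h : cb.IsProjectionCover a c) : a ≤ c :=
  (h.2 c h.1).2 le_rfl

theorem IsProjectionCover.unique {a c d : E} (h : cb.IsProjectionCover a c)
    (h' : cb.IsProjectionCover a d) : c = d :=
  le_antisymm ((h.2 d h'.1).1 h'.le) ((h'.2 c h.1).1 h.le)

/-- The covers of J_q(x) and J_{q'}(x) are orthogonal, and their sum is the cover of x. -/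
theorem IsProjectionCover.of_commutant (hcov : cb.ProjectionCoverProperty) {x c q : E}
    (h : cb.IsProjectionCover x c) (hq : q ∈ cb.P) (hx : x ∈ cb.commutant q) :
    c ∈ cb.commutant q ∧ cb.IsProjectionCover (cb.J q x) (cb.J q c) := by
  obtain ⟨r, hr⟩ := hcov (cb.J q x)
  obtain ⟨s, hs⟩ := hcov (cb.J (ortho q) x)
  have hrq : r ≤ q := (hr.2 q hq).1 (J_le hq x)
  have hsq : s ≤ ortho q := (hs.2 _ (cb.ortho_mem hq)).1 (J_le (cb.ortho_mem hq) x)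
  obtain ⟨t, ht⟩ := exists_add_of_le_ortho (hrq.trans (le_ortho_comm.1 hsq))
  have htP := cb.add_mem hr.1 hs.1 ht
  have h1 : c ≤ t := by
    refine (h.2 t htP).1 (le_of_add_le htP hx ?_ ?_)
    · exact hr.le.trans (le_of_add ht)
    · exact hs.le.trans (le_of_add' ht)
  have h2 : t ≤ c := by
    refine le_of_add_le h.1 ht ((hr.2 c h.1).1 ?_) ((hs.2 c h.1).1 ?_)
    · exact (J_le_self hx).trans h.le
    · exact (J_le_self (mem_commutant_ortho hx)).trans h.le
  obtain rfl := le_antisymm h1 h2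
  refine ⟨mem_commutant_of_add hq ht hrq hsq, ?_⟩
  rwa [(J_eq_of_add hq ht hrq hsq).1]

theorem IsProjectionCover.of_le (hcov : cb.ProjectionCoverProperty) {x u s : E}
    (h : cb.IsProjectionCover x u) (hs : s ∈ cb.P) (hx : x ∈ cb.commutant s) (hsu : s ≤ u) :
    cb.IsProjectionCover (cb.J s x) s := by
  obtain ⟨h1, h2⟩ := h.of_commutant hcov hs hx
  rwa [J_comm_of_mem h.1 hs h1 |>.symm, J_eq_self h.1 hsu] at h2

theorem IsProjectionCover.J_eq_zero_iff {x u g : E} (h : cb.IsProjectionCover x u)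
    (hg : g ∈ cb.P) : cb.J g x = 0 ↔ cb.J g u = 0 := by
  rw [CompressionBase.J_eq_zero_iff hg, CompressionBase.J_eq_zero_iff hg,
    h.2 _ (cb.ortho_mem hg)]

end

end CompressionBase

/-! ### The double commutant and positive parts. -/

namespace CompressionBase

open EffectAlgebra

variable {E : Type v} [EffectAlgebra E] (cb : CompressionBase E)

/-- The elements commuting with all projections that commute with `a`. -/
def doubleCommutant (a : E) : Set E := {x | ∀ q ∈ cb.PC {a}, x ∈ cb.commutant q}

/-- The projections in the double commutant of `a`. -/
def block (a : E) : Set E := {p | p ∈ cb.P ∧ p ∈ cb.doubleCommutant a}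

variable {cb}

theorem mem_PC_singleton {a p : E} : p ∈ cb.PC {a} ↔ p ∈ cb.P ∧ a ∈ cb.commutant p := by
  simp only [PC, Set.mem_ofPred_eq, Set.mem_singleton_iff, forall_eq]

/-- With d the Boolean meet of p and q, the difference p ⊖ d is disjoint from q, and q' is
codisjoint from q; hence p ⊖ d ≤ q' and p = d ⊕ (p ⊖ d) splits along q. Working through φ keeps the
Boolean order on T apart from the order of E. -/
theorem mem_commutant_of_booleanAlgebra {T : Type*} [BooleanAlgebra T] (φ : T → E)
    (hle : ∀ x y : T, x ≤ y ↔ φ x ≤ φ y) (hP : ∀ x, φ x ∈ cb.P)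
    (hsub : IsSubEffectAlgebra (Set.range φ)) (p q : T) : φ p ∈ cb.commutant (φ q) := by
  have hdp : φ (p ⊓ q) ≤ φ p := (hle _ _).1 inf_le_left
  have hdq : φ (p ⊓ q) ≤ φ q := (hle _ _).1 inf_le_right
  obtain ⟨r', hr⟩ := le_iff_emb.1 hdp
  obtain ⟨r, rfl⟩ := hsub.sub_mem ⟨_, rfl⟩ ⟨_, rfl⟩ hr
  obtain ⟨q', hq'⟩ := hsub.ortho_mem ⟨q, rfl⟩
  have h1 : Codisjoint q q' := by
    intro x hx hx'
    rw [hle] at hx hx' ⊢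
    rw [hq'] at hx'
    have h2 : ortho (φ x) ≤ φ q := by rw [← ortho_ortho (φ q)]; exact ortho_anti hx'
    have h3 := (J_eq_zero_iff (hP q)).2 (ortho_anti hx)
    rw [J_eq_self (hP q) h2] at h3
    rw [← ortho_ortho (φ x), h3, ortho_zero]
    exact ea_le_one _
  have h2 : Disjoint r q := by
    intro x hx hx'
    have h3 : x ≤ p ⊓ q := le_inf (hx.trans ((hle _ _).2 (le_of_add' hr))) hx'
    rw [hle] at hx h3
    have h4 := (J_eq_zero_iff (hP (p ⊓ q))).2
      (hx.trans (le_ortho_of_add ((add_comm _ _).trans hr)))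
    rw [J_eq_self (hP (p ⊓ q)) h3] at h4
    exact (hle _ _).2 (h4 ▸ ea_zero_le _)
  refine mem_commutant_of_add (hP q) hr hdq ?_
  rw [← hq']
  exact (hle _ _).1 (h2.le_of_codisjoint h1)

theorem IsBooleanSubalgebra.mem_commutant {B : Set E} (hB : cb.IsBooleanSubalgebra B) {p q : E}
    (hp : p ∈ B) (hq : q ∈ B) : p ∈ cb.commutant q := by
  obtain ⟨hBP, hsub, inst, hle⟩ := hB
  refine @mem_commutant_of_booleanAlgebra _ _ cb B inst Subtype.val hle (fun x => hBP x.2) ?_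
    ⟨p, hp⟩ ⟨q, hq⟩
  rwa [Subtype.range_coe]

section Closure

variable {a : E}

theorem self_mem_doubleCommutant : a ∈ cb.doubleCommutant a :=
  fun _ hq => (mem_PC_singleton.1 hq).2

theorem one_mem_doubleCommutant : (1 : E) ∈ cb.doubleCommutant a :=
  fun _ hq => one_mem_commutant hq.1

theorem doubleCommutant_ortho {x : E} (hx : x ∈ cb.doubleCommutant a) :
    ortho x ∈ cb.doubleCommutant a :=
  fun q hq => ortho_mem_commutant hq.1 (hx q hq)

theorem doubleCommutant_add {x y z : E} (hx : x ∈ cb.doubleCommutant a)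
    (hy : y ∈ cb.doubleCommutant a) (h : emb x + emb y = emb z) : z ∈ cb.doubleCommutant a :=
  fun q hq => commutant_add hq.1 (hx q hq) (hy q hq) h

theorem doubleCommutant_sub {x y z : E} (hx : x ∈ cb.doubleCommutant a)
    (hz : z ∈ cb.doubleCommutant a) (h : emb x + emb y = emb z) : y ∈ cb.doubleCommutant a :=
  fun q hq => commutant_sub hq.1 (hx q hq) (hz q hq) h

theorem doubleCommutant_J {x p : E} (hp : p ∈ cb.block a) (hx : x ∈ cb.doubleCommutant a) :
    cb.J p x ∈ cb.doubleCommutant a :=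
  fun q hq => J_mem_commutant hp.1 hq.1 (hp.2 q hq) (hx q hq)

theorem one_mem_block : (1 : E) ∈ cb.block a := ⟨cb.one_mem, one_mem_doubleCommutant⟩

theorem block_ortho {p : E} (hp : p ∈ cb.block a) : ortho p ∈ cb.block a :=
  ⟨cb.ortho_mem hp.1, doubleCommutant_ortho hp.2⟩

theorem block_add {p q r : E} (hp : p ∈ cb.block a) (hq : q ∈ cb.block a)
    (h : emb p + emb q = emb r) : r ∈ cb.block a :=
  ⟨cb.add_mem hp.1 hq.1 h, doubleCommutant_add hp.2 hq.2 h⟩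

theorem block_sub {p q r : E} (hp : p ∈ cb.block a) (hr : r ∈ cb.block a)
    (h : emb p + emb q = emb r) : q ∈ cb.block a :=
  ⟨cb.sub_mem hp.1 hr.1 h, doubleCommutant_sub hp.2 hr.2 h⟩

theorem IsProjectionCover.mem_block (hcov : cb.ProjectionCoverProperty) {x c : E}
    (h : cb.IsProjectionCover x c) (hx : x ∈ cb.doubleCommutant a) : c ∈ cb.block a :=
  ⟨h.1, fun q hq => (h.of_commutant hcov hq.1 (hx q hq)).1⟩

/-- The Boolean algebra B attached to a commutes with itself, so B ⊆ PC(a). A projection in the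
double commutant therefore commutes with B, and so with a. Consequently the block is commutative. -/
theorem BProperty.mem_PC (hb : cb.BProperty) {p : E} (hp : p ∈ cb.block a) : p ∈ cb.PC {a} := by
  obtain ⟨B, hB, h⟩ := hb a
  have h1 : ∀ b ∈ B, b ∈ cb.PC {a} := fun b hbB => mem_PC_singleton.2
    ⟨hB.1 hbB, (h b (hB.1 hbB)).2 fun c hc => hB.mem_commutant hc hbB⟩
  exact mem_PC_singleton.2 ⟨hp.1, (h p hp.1).2 fun b hbB =>
    commutant_symm hp.1 (hB.1 hbB) (hp.2 b (h1 b hbB))⟩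

theorem BProperty.mem_commutant (hb : cb.BProperty) {x p : E} (hx : x ∈ cb.doubleCommutant a)
    (hp : p ∈ cb.block a) : x ∈ cb.commutant p := hx p (hb.mem_PC hp)

theorem mem_block_of_mem_PC {A : Set E} {p : E} (hA : A ⊆ cb.doubleCommutant a)
    (hp : p ∈ cb.bicommutant A) : p ∈ cb.block a :=
  ⟨hp.1, fun q hq => commutant_symm hq.1 hp.1
    (hp.2 q (Or.inl ⟨hq.1, fun _ hx => hA hx q hq⟩))⟩

theorem BProperty.commute (hb : cb.BProperty) {e f : E} (he : e ∈ cb.doubleCommutant a)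
    (hf : f ∈ cb.doubleCommutant a) : cb.Commute e f := by
  intro p hp q hq
  have hp := mem_block_of_mem_PC (Set.singleton_subset_iff.2 he) hp
  have hq := mem_block_of_mem_PC (Set.singleton_subset_iff.2 hf) hq
  exact (mackeyCompatible_iff hq.1).2 (hb.mem_commutant hp.2 hq)

theorem PLe_subset_block {e f p : E} (he : e ∈ cb.doubleCommutant a)
    (hf : f ∈ cb.doubleCommutant a) (hp : p ∈ cb.PLe e f) : p ∈ cb.block a :=
  mem_block_of_mem_PC (Set.insert_subset_iff.2 ⟨he, Set.singleton_subset_iff.2 hf⟩) hp.1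

theorem BComparability.exists_isPosPart (hc : cb.BComparability) {e f : E}
    (he : e ∈ cb.doubleCommutant a) (hf : f ∈ cb.doubleCommutant a) :
    ∃ x, cb.IsPosPart e f x := by
  obtain ⟨p, hp⟩ := hc.nonempty_PLe f e (hc.bProperty.commute hf he)
  obtain ⟨x, hx⟩ := le_iff_emb.1 hp.2.1
  exact ⟨x, p, hp, hx⟩

namespace IsPosPart

variable {e f x : E}

theorem mem_doubleCommutant (h : cb.IsPosPart e f x) (he : e ∈ cb.doubleCommutant a)
    (hf : f ∈ cb.doubleCommutant a) : x ∈ cb.doubleCommutant a := by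
  obtain ⟨p, hp, hx⟩ := h
  have hpb := PLe_subset_block hf he hp
  exact doubleCommutant_sub (doubleCommutant_J hpb hf) (doubleCommutant_J hpb he) hx

/-- For p, q in P_≤(f, e), the part built with p is annihilated by J_{q'}, since e is dominated by f
there. Both parts thus equal J_qJ_p(e) ⊖ J_qJ_p(f), which is symmetric in p and q. -/
theorem unique (hb : cb.BProperty) {y : E} (h : cb.IsPosPart e f x) (h' : cb.IsPosPart e f y)
    (he : e ∈ cb.doubleCommutant a) (hf : f ∈ cb.doubleCommutant a) : x = y := by
  have key : ∀ {p q x : E}, p ∈ cb.PLe f e → q ∈ cb.PLe f e →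
      emb (cb.J p f) + emb x = emb (cb.J p e) →
      emb (cb.J q (cb.J p f)) + emb x = emb (cb.J q (cb.J p e)) := by
    intro p q x hp hq hx
    have hpb := PLe_subset_block hf he hp
    have hqb := PLe_subset_block hf he hq
    have hpq := mem_commutant_ortho (hb.mem_commutant hpb.2 hqb)
    have h1 := J_add (block_ortho hqb).1 hx
    have h2 := J_mono hpb.1 hq.2.2
    rw [J_J_comm hpb.1 (block_ortho hqb).1 hpq, J_J_comm hpb.1 (block_ortho hqb).1 hpq] at h2
    have h3 := le_antisymm (le_of_add h1) h2
    rw [h3] at h1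
    have h4 := (J_ortho_eq_zero_iff hqb.1).1 (eq_zero_of_oplus_self h1)
    have h5 := J_add hqb.1 hx
    rwa [J_eq_self hqb.1 h4] at h5
  obtain ⟨p, hp, hx⟩ := h
  obtain ⟨q, hq, hy⟩ := h'
  have hpb := PLe_subset_block hf he hp
  have hqb := PLe_subset_block hf he hq
  have h1 := key hp hq hx
  have h2 := key hq hp hy
  have hpq := hb.mem_commutant hpb.2 hqb
  rw [J_J_comm hpb.1 hqb.1 hpq, J_J_comm hpb.1 hqb.1 hpq] at h2
  exact emb_injective (add_left_cancel_of_emb h1 h2)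

theorem le (hb : cb.BProperty) (h : cb.IsPosPart e f x) (he : e ∈ cb.doubleCommutant a)
    (hf : f ∈ cb.doubleCommutant a) : x ≤ e := by
  obtain ⟨p, hp, hx⟩ := h
  exact (le_of_add' (oplus_eq_some_iff.1 hx)).trans (J_le_self
    (hb.mem_commutant he (PLe_subset_block hf he hp)))

theorem add_cover {r : E} (h : cb.IsPosPart e f x) (hr : cb.IsProjectionCover x r) :
    emb (cb.J r f) + emb x = emb (cb.J r e) := by
  obtain ⟨p, hp, hx⟩ := h
  have hpP := hp.1.1
  have hrp : r ≤ p := (hr.2 p hpP).1 ((le_of_add' (oplus_eq_some_iff.1 hx)).trans (J_le hpP e))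
  have h1 := J_add hr.1 hx
  rwa [J_J_of_le hr.1 hpP hrp, J_J_of_le hr.1 hpP hrp, J_eq_self hr.1 hr.le] at h1

/-- Off the cover of (e - f)_+, the parts of e and f under p agree, while under p' already e ≤ f.
Hence the comparison may be split along the cover r instead of the arbitrary choice p. -/
theorem le_of_le_ortho (hb : cb.BProperty) {r s : E} (h : cb.IsPosPart e f x)
    (hr : cb.IsProjectionCover x r) (he : e ∈ cb.doubleCommutant a)
    (hf : f ∈ cb.doubleCommutant a) (hs : s ∈ cb.P) (hsr : s ≤ ortho r) :
    cb.J s e ≤ cb.J s f := by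
  obtain ⟨p, hp, hx⟩ := h
  have hpb := PLe_subset_block hf he hp
  have h1 : cb.J s x = 0 := (J_eq_zero_iff hs).2 (hr.le.trans (le_ortho_comm.1 hsr))
  have h2 := J_add hs hx
  rw [h1, emb_zero, add_zero] at h2
  obtain ⟨z, hz⟩ := le_iff_emb.1 (J_mono hs hp.2.2)
  have h3 := J_add hs (hb.mem_commutant he hpb)
  have h4 := J_add hs (hb.mem_commutant hf hpb)
  apply le_of_add (x := emb z)
  rw [← h3, ← h4, h2, ← hz, add_assoc]

end IsPosPart

end Closure

end CompressionBase

/-! ### Binary strings and iterated doubling. -/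

theorem binK_append_singleton (w : List Bool) (i : Bool) :
    binK (w ++ [i]) = 2 * binK w + i.toNat := by
  simp only [binK, List.foldl_append, List.foldl_cons, List.foldl_nil]

theorem binK_cons (i : Bool) (w : List Bool) :
    binK (i :: w) = i.toNat * 2 ^ w.length + binK w := by
  induction w using List.reverseRecOn with
  | nil => simp [binK]
  | append_singleton w j ih =>
    rw [← List.cons_append, binK_append_singleton, binK_append_singleton, ih, List.length_append,
      List.length_singleton, pow_succ]
    ring

theorem binK_cons_false (w : List Bool) : binK (false :: w) = binK w := by
  rw [binK_cons, Bool.toNat_false, zero_mul, zero_add]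

theorem binK_cons_true (w : List Bool) : binK (true :: w) = 2 ^ w.length + binK w := by
  rw [binK_cons, Bool.toNat_true, one_mul]

theorem binK_replicate_false (n : ℕ) : binK (List.replicate n false) = 0 := by
  induction n with
  | zero => rfl
  | succ n ih => rw [List.replicate_succ, binK_cons_false, ih]

namespace EffectAlgebra

variable {E : Type v} [EffectAlgebra E]

theorem isDoubling_unique {s b d d' : E} {i : Bool} (h : IsDoubling s i b d)
    (h' : IsDoubling s i b d') : d = d' := by
  cases i with
  | false => exact Option.some_inj.1 (h.1.symm.trans h'.1)
  | true =>
    obtain ⟨x, e, h1, h2, h3⟩ := h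
    obtain ⟨x', e', h1', h2', h3'⟩ := h'
    rw [oplus_eq_some_iff] at h1 h1' h3 h3'
    obtain rfl := emb_injective (add_left_cancel_of_emb h1 h1')
    obtain rfl := Option.some_inj.1 (h2.symm.trans h2')
    exact emb_injective (add_left_cancel_of_emb h3 h3')

theorem eq_zero_of_add_self_le {s e : E} (h : emb s + emb s = emb e) (hle : e ≤ s) : s = 0 := by
  obtain rfl := le_antisymm hle (le_of_add h)
  exact eq_zero_of_oplus_self h

/-- Doubling f_0 fixes 0, and the first digit 1 would require 2s to exist in [0, s]. -/
theorem isIteratedDoubling_zero {s : E} (w : List Bool) {d : E}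
    (h : IsIteratedDoubling s w 0 d) (hw : 0 < binK w) : s = 0 := by
  induction w with
  | nil => simp [binK] at hw
  | cons i w ih =>
    obtain ⟨e, h1, h2⟩ := h
    cases i with
    | false =>
      rw [binK_cons_false] at hw
      obtain rfl : (0 : E) = e := Option.some_inj.1 ((oplus_zero 0).symm.trans h1.1)
      exact ih h2 hw
    | true =>
      obtain ⟨x, y, h3, h4, h5⟩ := h1
      rw [oplus_eq_some_iff, emb_zero, zero_add] at h3
      obtain rfl := emb_injective h3
      exact eq_zero_of_add_self_le h4 (le_of_add (oplus_eq_some_iff.1 h5))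

/-- Dually, f_1 fixes s, and the first digit 0 would require 2s to exist in [0, s]; the bound on
`binK w` says that such a digit occurs. -/
theorem isIteratedDoubling_top {s : E} (w : List Bool) {d : E}
    (h : IsIteratedDoubling s w s d) (hw : binK w + 1 < 2 ^ w.length) : s = 0 := by
  induction w with
  | nil => simp [binK] at hw
  | cons i w ih =>
    obtain ⟨e, h1, h2⟩ := h
    cases i with
    | false => exact eq_zero_of_add_self_le h1.1 h1.2
    | true =>
      obtain ⟨x, y, h3, h4, h5⟩ := h1
      rw [binK_cons_true, List.length_cons, pow_succ] at hw
      obtain rfl := eq_zero_of_oplus_self h3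
      rw [oplus_eq_some_iff, emb_zero, zero_add] at h4
      obtain rfl := emb_injective h4
      rw [oplus_eq_some_iff, emb_zero, zero_add] at h5
      obtain rfl := emb_injective h5
      exact ih h2 (by omega)

/-- Strip common leading digits. Where the strings first differ, y must be exactly half of s, and
then the tails follow 0 or s, which the gap between the two dyadic intervals forbids unless s = 0.
-/
theorem eq_zero_of_isIteratedDoubling {s : E} (w v : List Bool) {y d d' : E}
    (hw : IsIteratedDoubling s w y d) (hv : IsIteratedDoubling s v y d')
    (h : (binK v + 1) * 2 ^ w.length < binK w * 2 ^ v.length) : s = 0 := by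
  induction w generalizing v y with
  | nil => simp [binK] at h
  | cons i w ih =>
    cases v with
    | nil =>
      have h1 := binK_lt (i :: w)
      simp only [binK, List.foldl_nil, List.length_nil, pow_zero, mul_one, zero_add, one_mul] at h h1
      omega
    | cons j v =>
      obtain ⟨e, h1, h2⟩ := hw
      obtain ⟨e', h1', h2'⟩ := hv
      have hwlt := binK_lt w
      have hvlt := binK_lt v
      simp only [List.length_cons, pow_succ] at h
      cases i <;> cases j <;> simp only [binK_cons_true, binK_cons_false] at h
      · obtain rfl := isDoubling_unique h1 h1'
        exact ih v h2 h2' (by linarith)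
      · nlinarith
      · obtain ⟨b, c, h3, h4, h5⟩ := h1
        obtain ⟨h6, h7⟩ := h1'
        -- Here s = 2y ⊕ z = 2b ⊕ e and s = y ⊕ b. So b = y ⊕ z and y = b ⊕ e, which forces z = e =
        -- 0: one doubling of y yields s, the other 0.
        obtain ⟨z, hz⟩ := le_iff_emb.1 h7
        rw [oplus_eq_some_iff] at h3 h4 h5 h6
        have h8 : emb y + (emb y + emb z) = emb s := by rw [← hz, ← h6]; abel
        have h9 : emb b + (emb b + emb e) = emb s := by rw [← h5, ← h4]; abel
        have h10 := add_left_cancel_of_emb h8 h3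
        have h11 := add_left_cancel_of_emb h9 ((add_comm _ _).trans h3)
        have h12 : emb y + (emb z + emb e) = emb y := by rw [← add_assoc, h10, h11]
        obtain ⟨t, ht⟩ := exists_emb_right h12
        rw [ht] at h12
        rw [eq_zero_of_oplus_self h12] at ht
        obtain rfl := eq_zero_of_add_eq_zero ht
        rw [emb_zero, add_zero] at hz
        rw [emb_zero, zero_add] at ht
        obtain rfl := emb_injective hz
        obtain rfl := emb_injective ht
        -- If the tail of w is all zeros and that of v all ones, the intervals touch at 1/2, against
        -- the strict inequality.
        rcases Nat.eq_zero_or_pos (binK w) with h0 | h0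
        · refine isIteratedDoubling_top v h2' ?_
          by_contra hcon
          have h13 : binK v + 1 = 2 ^ v.length := by omega
          rw [h0, h13] at h
          linarith
        · exact isIteratedDoubling_zero w h2 h0
      · obtain rfl := isDoubling_unique h1 h1'
        exact ih v h2 h2' (by linarith)

theorem isIteratedDoubling_append_singleton {s b c d : E} {w : List Bool} {i : Bool}
    (h : IsIteratedDoubling s w b c) (h' : IsDoubling s i c d) :
    IsIteratedDoubling s (w ++ [i]) b d := by
  induction w generalizing b with
  | nil =>
    obtain rfl : c = b := h
    exact ⟨d, h', rfl⟩
  | cons j w ih =>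
    obtain ⟨e, h1, h2⟩ := h
    exact ⟨e, h1, ih h2⟩

theorem isIteratedDoubling_replicate_false (s : E) (n : ℕ) :
    IsIteratedDoubling s (List.replicate n false) 0 0 := by
  induction n with
  | zero => rfl
  | succ n ih => exact ⟨0, ⟨oplus_zero 0, ea_zero_le s⟩, ih⟩

/-- If `s = δe ⊕ βf` and `x = γe ⊕ αf`, where the interval `[α/β, γ/δ]` is contained in
`[λ(v), λ(v+1)]`, then `f_v(x)` exists in `[0, s]`. -/
theorem exists_isIteratedDoubling {s e f : E} {β δ : ℕ}
    (hs : δ • emb e + β • emb f = emb s) (v : List Bool) {x : E} {α γ : ℕ}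
    (hx : γ • emb e + α • emb f = emb x)
    (h1 : binK v * β ≤ 2 ^ v.length * α) (h2 : binK v * δ ≤ 2 ^ v.length * γ)
    (h3 : 2 ^ v.length * γ ≤ (binK v + 1) * δ) (h4 : 2 ^ v.length * α ≤ (binK v + 1) * β) :
    ∃ d, IsIteratedDoubling s v x d := by
  induction v generalizing x α γ with
  | nil => exact ⟨x, rfl⟩
  | cons i v ih =>
    have hlt := binK_lt v
    have hpos : 0 < 2 ^ v.length := by positivity
    rw [List.length_cons, pow_succ] at h1 h2 h3 h4
    cases i with
    | false =>
      rw [binK_cons_false] at h1 h2 h3 h4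
      have h5 : 2 * γ ≤ δ := by
        refine Nat.le_of_mul_le_mul_left ?_ hpos
        have := Nat.mul_le_mul_right δ (Nat.succ_le_of_lt hlt)
        linarith
      have h6 : 2 * α ≤ β := by
        refine Nat.le_of_mul_le_mul_left ?_ hpos
        have := Nat.mul_le_mul_right β (Nat.succ_le_of_lt hlt)
        linarith
      obtain ⟨t, rfl⟩ := Nat.exists_eq_add_of_le h5
      obtain ⟨r, rfl⟩ := Nat.exists_eq_add_of_le h6
      have h7 : (2 * γ) • emb e + (2 * α) • emb f + (t • emb e + r • emb f) = emb s := by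
        rw [← hs]; simp only [add_smul]; abel
      obtain ⟨y, hy⟩ := exists_emb_left h7
      obtain ⟨d, hd⟩ := ih hy (by linarith) (by linarith) (by linarith) (by linarith)
      refine ⟨d, y, ⟨?_, ?_⟩, hd⟩
      · rw [oplus_eq_some_iff, ← hy, ← hx]
        simp only [two_mul, add_smul]
        abel
      · rw [hy] at h7
        exact le_of_add h7
    | true =>
      rw [binK_cons_true] at h1 h2 h3 h4
      have h5 : γ ≤ δ := by
        refine Nat.le_of_mul_le_mul_left ?_ hpos
        have := Nat.mul_le_mul_right δ (Nat.succ_le_of_lt hlt)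
        linarith
      have h6 : α ≤ β := by
        refine Nat.le_of_mul_le_mul_left ?_ hpos
        have := Nat.mul_le_mul_right β (Nat.succ_le_of_lt hlt)
        linarith
      have h7 : δ ≤ 2 * γ := by
        refine Nat.le_of_mul_le_mul_left ?_ hpos
        have := Nat.zero_le (binK v * δ)
        linarith
      have h8 : β ≤ 2 * α := by
        refine Nat.le_of_mul_le_mul_left ?_ hpos
        have := Nat.zero_le (binK v * β)
        linarith
      obtain ⟨t, rfl⟩ := Nat.exists_eq_add_of_le h5
      obtain ⟨r, rfl⟩ := Nat.exists_eq_add_of_le h6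
      -- With t = δ - γ and r = β - α, the complement of x is te ⊕ rf, and f_1(x) has the
      -- coefficients γ - t = 2γ - δ and α - r = 2α - β.
      obtain ⟨g, rfl⟩ := Nat.exists_eq_add_of_le (show t ≤ γ by omega)
      obtain ⟨k, rfl⟩ := Nat.exists_eq_add_of_le (show r ≤ α by omega)
      have h9 : (t • emb e + r • emb f) + ((t • emb e + r • emb f) + (g • emb e + k • emb f))
          = emb s := by
        rw [← hs]; simp only [add_smul]; abel
      obtain ⟨b, hb⟩ := exists_emb_left h9
      rw [hb, ← add_assoc] at h9
      obtain ⟨c, hc⟩ := exists_emb_left h9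
      obtain ⟨y, hy⟩ := exists_emb_right h9
      rw [hc, hy] at h9
      obtain ⟨d, hd⟩ := ih hy (by linarith) (by linarith) (by linarith) (by linarith)
      refine ⟨d, y, ⟨b, c, ?_, hc, h9⟩, hd⟩
      rw [oplus_eq_some_iff, ← hb, ← hx, ← hs]
      simp only [add_smul]
      abel

end EffectAlgebra

/-! ### Pieces: doublings of a on a projection. -/

namespace CompressionBase

open EffectAlgebra

variable {E : Type v} [EffectAlgebra E] (cb : CompressionBase E)

/-- `f_w(J_r(a))` exists in `[0, r]`. -/
def Doubles (a r : E) (w : List Bool) : Prop := ∃ d, IsIteratedDoubling r w (cb.J r a) d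

variable {cb}

theorem isDoubling_J {u s b d : E} {i : Bool} (hs : s ∈ cb.P) (hsu : cb.J s u = s)
    (h : IsDoubling u i b d) : IsDoubling s i (cb.J s b) (cb.J s d) := by
  cases i with
  | false =>
    refine ⟨J_add hs h.1, ?_⟩
    have := J_mono hs h.2
    rwa [hsu] at this
  | true =>
    obtain ⟨x, y, h1, h2, h3⟩ := h
    have h4 := J_add hs h1
    have h5 := J_add hs h3
    rw [hsu] at h4 h5
    exact ⟨_, _, h4, J_add hs h2, h5⟩

theorem isIteratedDoubling_J {u s : E} (hs : s ∈ cb.P) (hsu : cb.J s u = s) (w : List Bool)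
    {b d : E} (h : IsIteratedDoubling u w b d) :
    IsIteratedDoubling s w (cb.J s b) (cb.J s d) := by
  induction w generalizing b with
  | nil => exact congrArg (cb.J s) h
  | cons i w ih =>
    obtain ⟨e, h1, h2⟩ := h
    exact ⟨_, isDoubling_J hs hsu h1, ih h2⟩

theorem J_eq_of_le {s u : E} (hs : s ∈ cb.P) (hu : u ∈ cb.P) (h : s ≤ u) : cb.J s u = s := by
  rw [J_comm_of_mem hs hu (mem_commutant_of_le hu h), J_eq_self hu h]

theorem Doubles.of_le {a u s : E} {w : List Bool} (h : cb.Doubles a u w) (hu : u ∈ cb.P)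
    (hs : s ∈ cb.P) (hsu : s ≤ u) : cb.Doubles a s w := by
  obtain ⟨d, hd⟩ := h
  have h1 := isIteratedDoubling_J hs (J_eq_of_le hs hu hsu) w hd
  rw [J_J_of_le hs hu hsu] at h1
  exact ⟨_, h1⟩

/-- For compatible u and r, the projection J_u(r) lies below both and inherits both doublings, so it
is zero. -/
theorem Doubles.J_eq_zero {a u r : E} {v w : List Bool} (hv : cb.Doubles a u v)
    (hw : cb.Doubles a r w) (hu : u ∈ cb.P) (hr : r ∈ cb.P) (hur : u ∈ cb.commutant r)
    (h : (binK v + 1) * 2 ^ w.length < binK w * 2 ^ v.length) : cb.J u r = 0 := by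
  have hs := (J_J hu hr hur).1
  have h1 : cb.J u r ≤ r := J_le_self (commutant_symm hu hr hur)
  obtain ⟨d, hd⟩ := hv.of_le hu hs (J_le hu r)
  obtain ⟨d', hd'⟩ := hw.of_le hr hs h1
  exact eq_zero_of_isIteratedDoubling w v hd' hd h

/-- Makes (a°)' and p_0 pieces over arbitrarily short intervals starting at 0. -/
theorem doubles_replicate_false {a u : E} (hu : cb.J u a = 0) (n : ℕ) :
    cb.Doubles a u (List.replicate n false) := by
  rw [Doubles, hu]
  exact ⟨0, isIteratedDoubling_replicate_false u n⟩

end CompressionBase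

/-! ### Dyadic numbers and their strings. -/

/-- The binary string of length `n` with value `k`. -/
def binStr : ℕ → ℕ → List Bool
  | 0, _ => []
  | n + 1, k => binStr n (k / 2) ++ [k % 2 == 1]

theorem length_binStr (n k : ℕ) : (binStr n k).length = n := by
  induction n generalizing k with
  | zero => rfl
  | succ n ih => rw [binStr, List.length_append, ih, List.length_singleton]

theorem binK_binStr {n k : ℕ} (h : k < 2 ^ n) : binK (binStr n k) = k := by
  induction n generalizing k with
  | zero => simp only [pow_zero] at h; simp [binStr, binK]; omega
  | succ n ih =>
    rw [pow_succ] at h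
    rw [binStr, binK_append_singleton, ih (by omega)]
    rcases Nat.mod_two_eq_zero_or_one k with h0 | h0 <;> simp [h0] <;> omega

theorem binVal_eq (w : List Bool) : ((binVal w : Set.Icc (0 : ℚ) 1) : ℚ) = binK w / 2 ^ w.length :=
  rfl

theorem binValSucc_eq (w : List Bool) :
    ((binValSucc w : Set.Icc (0 : ℚ) 1) : ℚ) = (binK w + 1) / 2 ^ w.length := rfl

theorem binValSucc_eq_add (w : List Bool) :
    ((binValSucc w : Set.Icc (0 : ℚ) 1) : ℚ) = (binVal w : ℚ) + 1 / 2 ^ w.length := by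
  rw [binValSucc_eq, binVal_eq, add_div]

theorem exists_one_div_two_pow_lt {x : ℚ} (hx : 0 < x) : ∃ n : ℕ, 1 / (2 : ℚ) ^ n < x := by
  obtain ⟨n, hn⟩ := exists_pow_lt_of_lt_one hx (by norm_num : (1 / 2 : ℚ) < 1)
  exact ⟨n, by rwa [one_div_pow] at hn⟩

/-! ### Stern–Brocot subdivision and existence of cuts. -/

namespace CompressionBase

open EffectAlgebra

variable {E : Type v} [EffectAlgebra E] (cb : CompressionBase E)

/-- The projection `g` is orthogonal to all projections on which `a` exceeds `l`. -/
def Avoids (a g : E) (l : ℚ) : Prop :=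
  ∀ r ∈ cb.block a, ∀ w : List Bool, cb.Doubles a r w → l < binVal w → cb.J g r = 0

/-- On the projection `u`, the element `a` lies between `α/β` and `γ/δ`: with
`e = β a - α u` and `f = γ u - δ a`, one has `u = δ e + β f` and `a = γ e + α f`. -/
structure IsFrame (a u e f : E) (α β γ δ : ℕ) : Prop where
  mem_block : u ∈ cb.block a
  left_mem : e ∈ cb.doubleCommutant a
  right_mem : f ∈ cb.doubleCommutant a
  unimodular : β * γ = α * δ + 1
  pos : 0 < δ
  le : γ ≤ δ
  sum_eq : δ • emb e + β • emb f = emb u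
  apply_eq : γ • emb e + α • emb f = emb (cb.J u a)
  cover : cb.IsProjectionCover e u

variable {cb} {a : E}

theorem Doubles.J_eq_zero_of_lt {u r : E} {v w : List Bool} (hv : cb.Doubles a u v)
    (hw : cb.Doubles a r w) (hu : u ∈ cb.P) (hr : r ∈ cb.P) (hur : u ∈ cb.commutant r)
    (h : ((binValSucc v : Set.Icc (0 : ℚ) 1) : ℚ) < binVal w) : cb.J u r = 0 := by
  refine hv.J_eq_zero hw hu hr hur ?_
  rw [binVal_eq, binValSucc_eq, div_lt_div_iff₀ (by positivity) (by positivity)] at h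
  exact_mod_cast h

namespace IsFrame

variable {u e f : E} {α β γ δ : ℕ}

theorem pos' (h : cb.IsFrame a u e f α β γ δ) : 0 < β := by
  rcases Nat.eq_zero_or_pos β with h0 | h0
  · have := h.unimodular
    rw [h0, zero_mul] at this
    omega
  · exact h0

theorem left_le (h : cb.IsFrame a u e f α β γ δ) : e ≤ u := h.cover.le

theorem right_le (h : cb.IsFrame a u e f α β γ δ) : f ≤ u := by
  obtain ⟨b, rfl⟩ := Nat.exists_eq_add_of_le' h.pos'
  have h1 := h.sum_eq
  rw [Nat.succ_eq_add_one, zero_add, add_smul, one_smul, ← add_assoc] at h1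
  exact le_of_add' h1

theorem lt_mediant (h : cb.IsFrame a u e f α β γ δ) :
    (α : ℚ) / β < ((α + γ : ℕ) : ℚ) / ((β + δ : ℕ) : ℚ) := by
  have h1 := h.pos'
  have h2 : (β : ℚ) * γ = α * δ + 1 := by exact_mod_cast h.unimodular
  rw [div_lt_div_iff₀ (by exact_mod_cast h1) (by exact_mod_cast Nat.add_pos_left h1 δ)]
  push_cast
  linarith

theorem mediant_lt (h : cb.IsFrame a u e f α β γ δ) :
    ((α + γ : ℕ) : ℚ) / ((β + δ : ℕ) : ℚ) < (γ : ℚ) / δ := by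
  have h1 := h.pos
  have h2 : (β : ℚ) * γ = α * δ + 1 := by exact_mod_cast h.unimodular
  rw [div_lt_div_iff₀ (by exact_mod_cast Nat.add_pos_left h.pos' δ) (by exact_mod_cast h1)]
  push_cast
  linarith

/-- The sign of e - f decides on which side of the mediant a lies. On s the pair (e, f) becomes (e,
f ⊖ e), on r it becomes (e ⊖ f, f). Taking r to be the cover of the positive part keeps `cover`
valid: a strictly exceeds the lower endpoint throughout each piece. -/
theorem split (hs : cb.IsSpectral) (h : cb.IsFrame a u e f α β γ δ) :
    ∃ s r x g, emb s + emb r = emb u ∧ emb (cb.J s e) + emb g = emb (cb.J s f) ∧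
      cb.IsFrame a s (cb.J s e) g α β (α + γ) (β + δ) ∧
      cb.IsFrame a r x (cb.J r f) (α + γ) (β + δ) γ δ := by
  have hb := hs.bComparability.bProperty
  have hcov := hs.projectionCoverProperty
  have hu := h.mem_block
  obtain ⟨x, hx⟩ := hs.bComparability.exists_isPosPart h.left_mem h.right_mem
  have hxD := hx.mem_doubleCommutant h.left_mem h.right_mem
  obtain ⟨r, hr⟩ := hcov x
  have hrb := hr.mem_block hcov hxD
  have hru : r ≤ u := (hr.2 u hu.1).1 ((hx.le hb h.left_mem h.right_mem).trans h.left_le)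
  obtain ⟨s, hs'⟩ := le_iff_emb.1 hru
  have hsb := block_sub hrb hu hs'
  have hsu : s ≤ u := le_of_add' hs'
  obtain ⟨g, hg⟩ := le_iff_emb.1 (hx.le_of_le_ortho hb hr h.left_mem h.right_mem hsb.1
    (le_ortho_of_add ((add_comm _ _).trans hs')))
  have hgD := doubleCommutant_sub (doubleCommutant_J hsb h.left_mem)
    (doubleCommutant_J hsb h.right_mem) hg
  have hadd := hx.add_cover hr
  refine ⟨s, r, x, g, (add_comm _ _).trans hs', hg, ?_, ?_⟩
  · have h1 := (cb.isAdditive hsb.1).pmap_comb h.sum_eq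
    have h2 := (cb.isAdditive hsb.1).pmap_comb h.apply_eq
    rw [J_eq_of_le hsb.1 hu.1 hsu, ← hg] at h1
    rw [J_J_of_le hsb.1 hu.1 hsu, ← hg] at h2
    refine ⟨hsb, doubleCommutant_J hsb h.left_mem, hgD, ?_, ?_, ?_, ?_, ?_, ?_⟩
    · have := h.unimodular
      linarith
    · exact Nat.add_pos_left h.pos' δ
    · have := h.unimodular
      have h3 := h.le
      have h4 : α ≤ β := by
        by_contra hcon
        have := Nat.mul_le_mul (le_of_not_ge hcon) h3
        omega
      omega
    · rw [← h1]; simp only [add_smul, smul_add]; abel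
    · rw [← h2]; simp only [add_smul, smul_add]; abel
    · exact h.cover.of_le hcov hsb.1 (hb.mem_commutant h.left_mem hsb) hsu
  · have h1 := (cb.isAdditive hrb.1).pmap_comb h.sum_eq
    have h2 := (cb.isAdditive hrb.1).pmap_comb h.apply_eq
    rw [J_eq_of_le hrb.1 hu.1 hru, ← hadd] at h1
    rw [J_J_of_le hrb.1 hu.1 hru, ← hadd] at h2
    refine ⟨hrb, hxD, doubleCommutant_J hrb h.right_mem, ?_, h.pos, h.le, ?_, ?_, hr⟩
    · have := h.unimodular
      linarith
    · rw [← h1]; simp only [add_smul, smul_add]; abel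
    · rw [← h2]; simp only [add_smul, smul_add]; abel

/-- An additive property of projections that holds on the pieces of a dyadic partition of mesh
`2⁻ᵐ` holds for `u`. -/
theorem induction_on_dyadic (hs : cb.IsSpectral) (m : ℕ) (Z : E → Prop)
    (hadd : ∀ s r u, s ∈ cb.block a → r ∈ cb.block a → emb s + emb r = emb u → Z s → Z r → Z u)
    (h : cb.IsFrame a u e f α β γ δ)
    (hbase : ∀ s ∈ cb.block a, ∀ v : List Bool, v.length = m → cb.Doubles a s v →
      (α : ℚ) / β < binValSucc v → binVal v < (γ : ℚ) / δ → Z s) : Z u := by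
  -- N bounds the remaining splittings: each adds β or δ, hence at least 1, to the sum of the two
  -- denominators.
  obtain ⟨N, hN⟩ : ∃ N, 2 ^ m < N + (β + δ) := ⟨2 ^ m + 1, by omega⟩
  induction N generalizing u e f α β γ δ with
  | zero =>
    have hβ := h.pos'
    have huni := h.unimodular
    have h1 : 2 ^ m * α / β * β ≤ 2 ^ m * α := Nat.div_mul_le_self _ _
    have h2 : 2 ^ m * α < (2 ^ m * α / β + 1) * β := by
      rw [mul_comm _ β]; exact Nat.lt_mul_div_succ _ hβ
    generalize hk : 2 ^ m * α / β = k at h1 h2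
    -- A fraction strictly between Farey neighbours has denominator at least β + δ > 2^m. So
    -- (k+1)/2^m does not fall strictly inside, and the frame fits into one dyadic interval.
    have h3 : 2 ^ m * γ ≤ (k + 1) * δ := by
      by_contra hcon
      have h4 := Nat.mul_le_mul_left β (Nat.succ_le_of_lt (not_le.1 hcon))
      have h5 := Nat.mul_le_mul_left δ (Nat.succ_le_of_lt h2)
      have h6 : 2 ^ m * (β * γ) = 2 ^ m * (α * δ + 1) := by rw [huni]
      simp only [Nat.succ_eq_add_one] at h4 h5
      nlinarith
    have h4 : k * δ < 2 ^ m * γ := by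
      have h5 := Nat.mul_le_mul_right δ h1
      have h6 : 2 ^ m * (β * γ) = 2 ^ m * (α * δ + 1) := by rw [huni]
      have h7 : 0 < 2 ^ m := by positivity
      refine Nat.lt_of_mul_lt_mul_left (a := β) ?_
      nlinarith
    have h5 : k < 2 ^ m := by
      refine Nat.lt_of_mul_lt_mul_right (a := δ) (h4.trans_le ?_)
      exact Nat.mul_le_mul_left _ h.le
    obtain ⟨v, rfl, rfl⟩ : ∃ v : List Bool, v.length = m ∧ binK v = k :=
      ⟨binStr m k, length_binStr m k, binK_binStr h5⟩
    refine hbase u h.mem_block v rfl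
      (exists_isIteratedDoubling h.sum_eq v h.apply_eq h1 h4.le h3 h2.le) ?_ ?_
    · rw [binValSucc_eq, div_lt_div_iff₀ (by exact_mod_cast hβ) (by positivity), mul_comm]
      exact_mod_cast h2
    · rw [binVal_eq, div_lt_div_iff₀ (by positivity) (by exact_mod_cast h.pos), mul_comm (γ : ℚ)]
      exact_mod_cast h4
  | succ N ih =>
    obtain ⟨s, r, x, g, hsr, -, h1, h2⟩ := h.split hs
    have hβ := h.pos'
    have hδ := h.pos
    refine hadd s r u h1.mem_block h2.mem_block hsr (ih h1 ?_ (by omega)) (ih h2 ?_ (by omega))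
    · exact fun t ht v hv hd hl hr => hbase t ht v hv hd hl (hr.trans h.mediant_lt)
    · exact fun t ht v hv hd hl hr => hbase t ht v hv hd (h.lt_mediant.trans hl) hr

/-- Choose the mesh below λ(w) - l. Each dyadic piece of u then ends strictly before λ(w), as
separation requires. -/
theorem avoids (hs : cb.IsSpectral) (h : cb.IsFrame a u e f α β γ δ) {l : ℚ}
    (hl : (γ : ℚ) / δ ≤ l) : cb.Avoids a u l := by
  intro r hr w hw hlw
  have hb := hs.bComparability.bProperty
  obtain ⟨m, hm⟩ := exists_one_div_two_pow_lt (sub_pos.2 hlw)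
  rw [J_eq_zero_comm h.mem_block.1 hr.1]
  refine induction_on_dyadic hs m (fun t => cb.J r t = 0)
    (fun _ _ _ _ _ hsr h1 h2 => J_eq_zero_of_add hr.1 hsr h1 h2) h ?_
  intro s hsb v hv hd _ hlt
  refine (J_eq_zero_comm hr.1 hsb.1).2
    (hd.J_eq_zero_of_lt hw hsb.1 hr.1 (hb.mem_commutant hsb.2 hr) ?_)
  rw [binValSucc_eq_add, hv]
  linarith

theorem J_eq_zero_of_avoids (hs : cb.IsSpectral) (h : cb.IsFrame a u e f α β γ δ) {l : ℚ}
    (hl : l < (α : ℚ) / β) {g : E} (hg : g ∈ cb.P) (hgl : cb.Avoids a g l) : cb.J g u = 0 := by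
  obtain ⟨m, hm⟩ := exists_one_div_two_pow_lt (sub_pos.2 hl)
  refine induction_on_dyadic hs m (fun t => cb.J g t = 0)
    (fun _ _ _ _ _ hsr h1 h2 => J_eq_zero_of_add hg hsr h1 h2) h ?_
  intro s hsb v hv hd hlt _
  refine hgl s hsb v hd ?_
  rw [binValSucc_eq_add, hv] at hlt
  linarith

/-- Each splitting removes one copy of e from f on the left half, while g annihilates the right
half, where a exceeds the mediant. The left endpoint α/β never changes, so this can be repeated j
times. -/
theorem exists_nsmul_add (hs : cb.IsSpectral) (h : cb.IsFrame a u e f α β γ δ) {g : E}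
    (hg : g ∈ cb.P) (hgl : cb.Avoids a g ((α : ℚ) / β)) (j : ℕ) :
    ∃ z, j • emb (cb.J g e) + emb z = emb (cb.J g f) := by
  have hb := hs.bComparability.bProperty
  induction j generalizing u e f γ δ with
  | zero => exact ⟨cb.J g f, by rw [zero_smul, zero_add]⟩
  | succ j ih =>
    obtain ⟨s, r, x, y, hsr, hsf, h1, h2⟩ := h.split hs
    have hgr := h2.J_eq_zero_of_avoids hs h.lt_mediant hg hgl
    have key : ∀ b ∈ cb.doubleCommutant a, b ≤ u → cb.J g b = cb.J g (cb.J s b) := by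
      intro b hbD hbu
      have h3 := J_add_J h1.mem_block.1 h.mem_block.1 hsr (hb.mem_commutant hbD h1.mem_block)
      rw [J_eq_self h.mem_block.1 hbu] at h3
      have h4 := J_add hg h3
      rw [J_eq_zero_of_le hg (J_le h2.mem_block.1 b) hgr, emb_zero, add_zero] at h4
      exact (emb_injective h4).symm
    obtain ⟨z, hz⟩ := ih h1
    refine ⟨z, ?_⟩
    rw [key e h.left_mem h.left_le, key f h.right_mem h.right_le, ← J_add hg hsf, ← hz, add_smul,
      one_smul]
    abel

/-- All multiples of J_g(e) exist, so it is zero; since u is the cover of e, g is orthogonal to u as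
well. -/
theorem J_eq_zero_of_avoids_left (hs : cb.IsSpectral) (harch : IsArchimedean E)
    (h : cb.IsFrame a u e f α β γ δ) {g : E} (hg : g ∈ cb.P)
    (hgl : cb.Avoids a g ((α : ℚ) / β)) : cb.J g u = 0 := by
  rw [← h.cover.J_eq_zero_iff hg]
  refine harch.eq_zero fun n => ?_
  obtain ⟨z, hz⟩ := h.exists_nsmul_add hs hg hgl n
  exact exists_emb_left hz

end IsFrame

theorem Avoids.add {s r u : E} {l : ℚ} (hs : s ∈ cb.P) (hr : r ∈ cb.P)
    (h : emb s + emb r = emb u) (h1 : cb.Avoids a s l) (h2 : cb.Avoids a r l) :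
    cb.Avoids a u l := by
  intro t ht w hw hl
  have hu := cb.add_mem hs hr h
  rw [J_eq_zero_comm hu ht.1]
  exact J_eq_zero_of_add ht.1 h ((J_eq_zero_comm hs ht.1).1 (h1 t ht w hw hl))
    ((J_eq_zero_comm hr ht.1).1 (h2 t ht w hw hl))

theorem avoids_of_J_eq_zero (hb : cb.BProperty) {u : E} (hu : u ∈ cb.block a) (h : cb.J u a = 0)
    {l : ℚ} (hl : 0 ≤ l) : cb.Avoids a u l := by
  intro r hr w hw hlw
  obtain ⟨n, hn⟩ := exists_one_div_two_pow_lt (hl.trans_lt hlw)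
  refine (doubles_replicate_false h n).J_eq_zero_of_lt hw hu.1 hr.1
    (hb.mem_commutant hu.2 hr) ?_
  rwa [binValSucc_eq, binK_replicate_false, Nat.cast_zero, zero_add, List.length_replicate]

theorem Avoids.mono {g : E} {l m : ℚ} (h : cb.Avoids a g l) (hlm : l ≤ m) : cb.Avoids a g m :=
  fun r hr w hw hm => h r hr w hw (hlm.trans_lt hm)

theorem Avoids.of_le {g p : E} {l : ℚ} (hg : g ∈ cb.P) (hp : p ∈ cb.P) (hgp : g ≤ p)
    (h : cb.Avoids a p l) : cb.Avoids a g l := by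
  intro r hr w hw hl
  rw [J_eq_zero_iff hg]
  exact ((J_eq_zero_iff hp).1 (h r hr w hw hl)).trans (ortho_anti hgp)

theorem avoids_zero {l : ℚ} : cb.Avoids a 0 l := by
  intro r _ w _ _
  rw [J_eq_zero_iff cb.isSubEffectAlgebra.zero_mem, ortho_zero]
  exact ea_le_one r

/-- Inside a frame, the part of `u` where `a` exceeds the rational number `k/n`. -/
theorem IsFrame.exists_cut (hs : cb.IsSpectral) (harch : IsArchimedean E) {k n : ℕ} (hn : 0 < n)
    {u e f : E} {α β γ δ : ℕ} (h : cb.IsFrame a u e f α β γ δ)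
    (h1 : (α : ℚ) / β ≤ k / n) (h2 : (k : ℚ) / n < γ / δ) :
    ∃ s r, s ∈ cb.block a ∧ r ∈ cb.block a ∧ emb s + emb r = emb u ∧ cb.Avoids a s (k / n) ∧
      ∀ g ∈ cb.P, cb.Avoids a g (k / n) → cb.J g r = 0 := by
  obtain ⟨N, hN⟩ : ∃ N, n < N + (β + δ) := ⟨n + 1, by omega⟩
  have hnQ : (0 : ℚ) < n := by exact_mod_cast hn
  have hleft : ∀ {u e f : E} {α β γ δ : ℕ}, cb.IsFrame a u e f α β γ δ → (α : ℚ) / β = k / n →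
      ∃ s r, s ∈ cb.block a ∧ r ∈ cb.block a ∧ emb s + emb r = emb u ∧ cb.Avoids a s (k / n) ∧
        ∀ g ∈ cb.P, cb.Avoids a g (k / n) → cb.J g r = 0 := by
    intro u e f α β γ δ h heq
    refine ⟨0, u, ?_, h.mem_block, by rw [emb_zero, zero_add], avoids_zero, ?_⟩
    · rw [← ortho_one]; exact block_ortho one_mem_block
    · intro g hg hgl
      rw [← heq] at hgl
      exact h.J_eq_zero_of_avoids_left hs harch hg hgl
  induction N generalizing u e f α β γ δ with
  | zero =>
    -- Now n < β + δ, so k/n cannot lie strictly between the Farey neighbours and must be the left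
    -- endpoint.
    refine hleft h (h1.eq_of_not_lt fun hlt => ?_)
    rw [div_lt_div_iff₀ (by exact_mod_cast h.pos') hnQ] at hlt
    rw [div_lt_div_iff₀ hnQ (by exact_mod_cast h.pos)] at h2
    have h3 : α * n + 1 ≤ k * β := by exact_mod_cast hlt
    have h4 : k * δ + 1 ≤ γ * n := by exact_mod_cast h2
    have h5 := Nat.mul_le_mul_left δ h3
    have h6 := Nat.mul_le_mul_left β h4
    have h7 : n * (β * γ) = n * (α * δ + 1) := by rw [h.unimodular]
    nlinarith
  | succ N ih =>
    obtain ⟨s, r, x, g, hsr, -, hfs, hfr⟩ := h.split hs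
    have hβ := h.pos'
    have hδ := h.pos
    rcases lt_or_ge ((k : ℚ) / n) (((α + γ : ℕ) : ℚ) / ((β + δ : ℕ) : ℚ)) with hlt | hge
    · obtain ⟨s', r', hs', hr', hsum, hav, hgr⟩ := ih hfs h1 hlt (by omega)
      have h3 : emb s' + (emb r' + emb r) = emb u := by rw [← hsr, ← hsum]; abel
      obtain ⟨t, ht⟩ := exists_emb_right h3
      rw [ht] at h3
      refine ⟨s', t, hs', block_add hr' hfr.mem_block ht, h3, hav, fun g hg hgl => ?_⟩
      exact J_eq_zero_of_add hg ht (hgr g hg hgl) (hfr.J_eq_zero_of_avoids hs hlt hg hgl)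
    · obtain ⟨s', r', hs', hr', hsum, hav, hgr⟩ := ih hfr hge h2 (by omega)
      have h3 : emb s + emb s' + emb r' = emb u := by rw [← hsr, ← hsum]; abel
      obtain ⟨t, ht⟩ := exists_emb_left h3
      rw [ht] at h3
      exact ⟨t, r', block_add hfs.mem_block hs' ht, hr', h3,
        (hfs.avoids hs hge).add hfs.mem_block.1 hs'.1 ht hav, hgr⟩

variable (cb a) in
/-- `p` is the largest projection avoiding `l`. -/
structure IsCut (l : ℚ) (p : E) : Prop where
  mem_block : p ∈ cb.block a
  avoids : cb.Avoids a p l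
  le : ∀ g ∈ cb.P, cb.Avoids a g l → g ≤ p

theorem IsCut.unique {l : ℚ} {p q : E} (hp : cb.IsCut a l p) (hq : cb.IsCut a l q) : p = q :=
  le_antisymm (hq.le p hp.mem_block.1 hp.avoids) (hp.le q hq.mem_block.1 hq.avoids)

theorem IsCut.le_of_le {l m : ℚ} {p q : E} (hp : cb.IsCut a l p) (hq : cb.IsCut a m q)
    (h : l ≤ m) : p ≤ q :=
  hq.le p hp.mem_block.1 (hp.avoids.mono h)

theorem isCut_one : cb.IsCut a 1 1 where
  mem_block := one_mem_block
  avoids _ _ w _ hw := absurd hw (not_lt.2 (binVal w).2.2)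
  le g _ _ := ea_le_one g

theorem exists_isFrame (hs : cb.IsSpectral) {u : E} (hu : cb.IsProjectionCover a u) :
    ∃ f, cb.IsFrame a u a f 0 1 1 1 := by
  obtain ⟨f, hf⟩ := le_iff_emb.1 hu.le
  have hub := hu.mem_block hs.projectionCoverProperty self_mem_doubleCommutant
  refine ⟨f, hub, self_mem_doubleCommutant,
    doubleCommutant_sub self_mem_doubleCommutant hub.2 hf, rfl, one_pos, le_rfl, ?_, ?_, hu⟩
  · rw [one_smul, one_smul, hf]
  · rw [one_smul, zero_smul, add_zero, J_eq_self hu.1 hu.le]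

theorem exists_isCut (hs : cb.IsSpectral) (harch : IsArchimedean E) (a : E)
    (l : Set.Icc (0 : ℚ) 1) : ∃ p, cb.IsCut a l p := by
  obtain ⟨u, hu⟩ := hs.projectionCoverProperty a
  obtain ⟨f, hf⟩ := exists_isFrame hs hu
  -- The subdivision starts from the frame with endpoints 0/1 and 1/1 and needs l strictly below the
  -- upper one.
  rcases l.2.2.eq_or_lt with h1 | h1
  · exact ⟨1, by rw [h1]; exact isCut_one⟩
  have hl : ((l : ℚ).num.toNat : ℚ) / (l : ℚ).den = l := by
    conv_rhs => rw [← Rat.num_div_den (l : ℚ)]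
    congr 1
    exact_mod_cast Int.toNat_of_nonneg (Rat.num_nonneg.2 l.2.1)
  obtain ⟨s, r, hsb, hrb, hsr, hav, hg⟩ := hf.exists_cut hs harch (k := (l : ℚ).num.toNat)
    (l : ℚ).den_pos (by rw [hl]; simpa using l.2.1) (by rw [hl]; simpa using h1)
  rw [hl] at hav hg
  have h2 := ortho_add_of_add hsr
  have hub := block_ortho hf.mem_block
  -- Since a° = s ⊕ r, the cut r' equals (a°)' ⊕ s.
  refine ⟨ortho r, block_ortho hrb, ?_, fun g hgP hgl => ?_⟩
  · refine (avoids_of_J_eq_zero hs.bComparability.bProperty hub ?_ l.2.1).add hub.1 hsb.1 h2 hav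
    exact (J_ortho_eq_zero_iff hu.1).2 hu.le
  · exact le_ortho_comm.1 ((J_eq_zero_iff hgP).1 (hg g hgP hgl))

end CompressionBase

/-! ### Enumeration of strings of fixed length. -/

theorem binStr_binK (w : List Bool) : binStr w.length (binK w) = w := by
  induction w using List.reverseRecOn with
  | nil => rfl
  | append_singleton w i ih =>
    rw [List.length_append, List.length_singleton, binStr, binK_append_singleton]
    cases i
    · rw [Bool.toNat_false, add_zero, Nat.mul_div_cancel_left _ two_pos, ih]; simp
    · rw [Bool.toNat_true, show (2 * binK w + 1) / 2 = binK w by omega, ih]; simp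

theorem binStr_two_mul (n j : ℕ) : binStr (n + 1) (2 * j) = binStr n j ++ [false] := by
  rw [binStr, Nat.mul_div_cancel_left _ two_pos]; simp

theorem binStr_two_mul_add_one (n j : ℕ) :
    binStr (n + 1) (2 * j + 1) = binStr n j ++ [true] := by
  rw [binStr, show (2 * j + 1) / 2 = j by omega]; simp

theorem length_of_mem_binStrings {n : ℕ} {w : List Bool} (h : w ∈ binStrings n) :
    w.length = n := by
  induction n generalizing w with
  | zero => rw [List.mem_singleton.1 h]; rfl
  | succ n ih =>
    rw [binStrings, List.mem_append, List.mem_map, List.mem_map] at h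
    rcases h with ⟨x, hx, rfl⟩ | ⟨x, hx, rfl⟩ <;> rw [List.length_cons, ih hx]

theorem map_binK_binStrings (n : ℕ) : (binStrings n).map binK = List.range (2 ^ n) := by
  induction n with
  | zero => rfl
  | succ n ih =>
    rw [binStrings, List.map_append, List.map_map, List.map_map, pow_succ, mul_two,
      List.range_add, ← ih, List.map_map]
    refine congrArg₂ _ (List.map_congr_left fun w _ => binK_cons_false w)
      (List.map_congr_left fun w hw => ?_)
    rw [Function.comp_apply, Function.comp_apply, binK_cons_true, length_of_mem_binStrings hw]

theorem binStrings_eq (n : ℕ) : binStrings n = (List.range (2 ^ n)).map (binStr n) := by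
  rw [← map_binK_binStrings, List.map_map]
  conv_lhs => rw [← List.map_id (binStrings n)]
  refine List.map_congr_left fun w hw => ?_
  rw [Function.comp_apply, ← length_of_mem_binStrings hw, binStr_binK, id]

theorem sum_filter_binStrings {M : Type*} [AddCommMonoid M] (g : List Bool → M) {n k : ℕ}
    (hk : k < 2 ^ n) :
    (((binStrings n).filter (fun v => binK v ≤ k)).map g).sum =
      ∑ j ∈ Finset.range (k + 1), g (binStr n j) := by
  have h1 : (List.range (2 ^ n)).filter ((fun v => decide (binK v ≤ k)) ∘ binStr n) =
      (List.range (2 ^ n)).filter (fun j => decide (j ≤ k)) := by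
    refine List.filter_congr fun j hj => ?_
    rw [Function.comp_apply, binK_binStr (List.mem_range.1 hj)]
  have h2 : (Finset.range (2 ^ n)).filter (fun j => j ≤ k) = Finset.range (k + 1) := by
    ext j
    simp only [Finset.mem_filter, Finset.mem_range]
    omega
  rw [binStrings_eq, List.filter_map, h1, List.map_map, ← h2]
  rfl

/-! ### The tree of splittings and its partial sums. -/

namespace CompressionBase

open EffectAlgebra

variable {E : Type v} [EffectAlgebra E] (cb : CompressionBase E)

/-- The nodes of the tree of iterated splittings of `a`. -/
structure IsNode (a u c : E) : Prop where
  mem_block : u ∈ cb.block a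
  mem_doubleCommutant : c ∈ cb.doubleCommutant a
  cover : cb.IsProjectionCover c u

/-- The properties of the family of iterated splittings of `a`. -/
structure IsTree (a : E) (u c : List Bool → E) : Prop where
  isSplittingFamily : cb.IsSplittingFamily a u c
  isNode : ∀ w, cb.IsNode a (u w) (c w)
  add_eq : ∀ w, emb (u (w ++ [false])) + emb (u (w ++ [true])) = emb (u w)
  isDoubling : ∀ w i,
    IsDoubling (u (w ++ [i])) i (cb.J (u (w ++ [i])) (c w)) (c (w ++ [i]))

variable {cb} {a : E}

/-- On s = u ⊖ r one has c ≤ c', so 2J_s(c) exists below s. On r the positive part satisfies r =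
2J_r(c') ⊕ x, which is precisely x = f_1(J_r(c)). -/
theorem IsNode.exists_isSplitting (hs : cb.IsSpectral) {u c : E} (h : cb.IsNode a u c) :
    ∃ u₀ u₁ c₀ c₁, cb.IsSplitting u c u₀ u₁ c₀ c₁ ∧ cb.IsNode a u₀ c₀ ∧ cb.IsNode a u₁ c₁ ∧
      emb u₀ + emb u₁ = emb u ∧ IsDoubling u₀ false (cb.J u₀ c) c₀ ∧
      IsDoubling u₁ true (cb.J u₁ c) c₁ := by
  have hb := hs.bComparability.bProperty
  have hcov := hs.projectionCoverProperty
  have hu := h.mem_block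
  have hc := h.mem_doubleCommutant
  have hc' := doubleCommutant_ortho hc
  obtain ⟨x, hx⟩ := hs.bComparability.exists_isPosPart hc hc'
  have hxD := hx.mem_doubleCommutant hc hc'
  obtain ⟨r, hr⟩ := hcov x
  have hrb := hr.mem_block hcov hxD
  have hxu : x ≤ u := (hx.le hb hc hc').trans h.cover.le
  have hru : r ≤ u := (hr.2 u hu.1).1 hxu
  obtain ⟨s, hrs⟩ := le_iff_emb.1 hru
  have hsb := block_sub hrb hu hrs
  have hsr := (add_comm _ _).trans hrs
  have h1 := J_add hsb.1 (emb_add_ortho c)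
  rw [cb.focus s hsb.1] at h1
  obtain ⟨y, hy⟩ := le_iff_emb.1 (hx.le_of_le_ortho hb hr hc hc' hsb.1 (le_ortho_of_add hsr))
  rw [← hy, ← add_assoc] at h1
  obtain ⟨d, hd⟩ := exists_emb_left h1
  rw [hd] at h1
  have hds := le_of_add h1
  refine ⟨s, r, d, x, ⟨x, r, hx, hr, isGLB_of_add hrb.1 hrs, ?_, hd, isGLB_pair_of_le hxu⟩,
    ⟨hsb, ?_, ?_⟩, ⟨hrb, hxD, hr⟩, hsr, ⟨hd, hds⟩, ?_⟩
  · rw [Set.pair_comm]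
    exact isGLB_of_add hsb.1 hsr
  · have := doubleCommutant_J hsb hc
    exact doubleCommutant_add this this hd
  -- Doubling does not change the cover: J_s(c) ≤ d ≤ s and s already covers J_s(c).
  · have h2 := h.cover.of_le hcov hsb.1 (hb.mem_commutant hc hsb) (le_of_add hsr)
    exact ⟨hsb.1, fun q hq => ⟨fun hdq => (h2.2 q hq).1 ((le_of_add hd).trans hdq), hds.trans⟩⟩
  · have h2 := hx.add_cover hr
    have h3 := J_add hrb.1 (emb_add_ortho c)
    rw [cb.focus r hrb.1] at h3
    have h4 : emb (cb.J r (ortho c)) + emb (cb.J r (ortho c)) + emb x = emb r := by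
      rw [← h3, ← h2]; abel
    obtain ⟨z, hz⟩ := exists_emb_left h4
    rw [hz] at h4
    exact ⟨_, z, h3, hz, h4⟩

theorem IsNode.isSplitting_unique (hs : cb.IsSpectral) {u c u₀ u₁ c₀ c₁ v₀ v₁ d₀ d₁ : E}
    (h : cb.IsNode a u c) (h1 : cb.IsSplitting u c u₀ u₁ c₀ c₁)
    (h2 : cb.IsSplitting u c v₀ v₁ d₀ d₁) : u₀ = v₀ ∧ u₁ = v₁ ∧ c₀ = d₀ ∧ c₁ = d₁ := by
  obtain ⟨x, r, hx, hr, hu₀, hu₁, hc₀, hc₁⟩ := h1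
  obtain ⟨y, t, hy, ht, hv₀, hv₁, hd₀, hd₁⟩ := h2
  obtain rfl := hx.unique hs.bComparability.bProperty hy h.mem_doubleCommutant
    (doubleCommutant_ortho h.mem_doubleCommutant)
  obtain rfl := hr.unique ht
  obtain rfl := hu₀.unique hv₀
  exact ⟨rfl, hu₁.unique hv₁, Option.some_inj.1 (hc₀.symm.trans hd₀), hc₁.unique hd₁⟩

theorem exists_isTree (hs : cb.IsSpectral) (a : E) : ∃ u c, cb.IsTree a u c := by
  obtain ⟨v, hv⟩ := hs.projectionCoverProperty a
  have hnode : cb.IsNode a v a := ⟨hv.mem_block hs.projectionCoverProperty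
    self_mem_doubleCommutant, self_mem_doubleCommutant, hv⟩
  have key : ∀ x : {x : E × E // cb.IsNode a x.1 x.2}, ∃ n : Bool → {x : E × E //
      cb.IsNode a x.1 x.2}, cb.IsSplitting x.1.1 x.1.2 (n false).1.1 (n true).1.1 (n false).1.2
        (n true).1.2 ∧ emb (n false).1.1 + emb (n true).1.1 = emb x.1.1 ∧
        ∀ i, IsDoubling (n i).1.1 i (cb.J (n i).1.1 x.1.2) (n i).1.2 := by
    rintro ⟨⟨u, c⟩, h⟩
    obtain ⟨u₀, u₁, c₀, c₁, h1, h2, h3, h4, h5, h6⟩ := h.exists_isSplitting hs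
    refine ⟨fun i => Bool.rec ⟨(u₀, c₀), h2⟩ ⟨(u₁, c₁), h3⟩ i, h1, h4, ?_⟩
    intro i
    cases i
    exacts [h5, h6]
  choose n hn1 hn2 hn3 using key
  let F : List Bool → {x : E × E // cb.IsNode a x.1 x.2} :=
    fun w => w.foldl (fun x i => n x i) ⟨(v, a), hnode⟩
  have hF : ∀ w i, F (w ++ [i]) = n (F w) i := fun w i => by
    simp only [F, List.foldl_append, List.foldl_cons, List.foldl_nil]
  refine ⟨fun w => (F w).1.1, fun w => (F w).1.2, ⟨rfl, hv, fun w => ?_⟩, fun w => (F w).2,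
    fun w => ?_, fun w i => ?_⟩
  · rw [hF, hF]; exact hn1 _
  · rw [hF, hF]; exact hn2 _
  · rw [hF]; exact hn3 _ _

namespace IsTree

variable {u c : List Bool → E}

theorem unique (hs : cb.IsSpectral) (h : cb.IsTree a u c) {u' c' : List Bool → E}
    (h' : cb.IsSplittingFamily a u' c') : u' = u := by
  have key : ∀ w, u' w = u w ∧ c' w = c w := by
    intro w
    induction w using List.reverseRecOn with
    | nil => exact ⟨h'.u_nil.unique h.isSplittingFamily.u_nil,
        h'.c_nil.trans h.isSplittingFamily.c_nil.symm⟩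
    | append_singleton w i ih =>
      have h1 := h'.split w
      rw [ih.1, ih.2] at h1
      obtain ⟨h2, h3, h4, h5⟩ := (h.isNode w).isSplitting_unique hs h1
        (h.isSplittingFamily.split w)
      cases i
      exacts [⟨h2, h4⟩, ⟨h3, h5⟩]
  exact funext fun w => (key w).1

theorem le (h : cb.IsTree a u c) (w : List Bool) (i : Bool) : u (w ++ [i]) ≤ u w := by
  cases i
  · exact le_of_add (h.add_eq w)
  · exact le_of_add' (h.add_eq w)

theorem doubles (h : cb.IsTree a u c) (w : List Bool) : cb.Doubles a (u w) w := by
  refine ⟨c w, ?_⟩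
  induction w using List.reverseRecOn with
  | nil =>
    have h1 := h.isSplittingFamily.c_nil
    have h2 := (h.isNode []).cover
    rw [h1] at h2
    rw [h1, J_eq_self h2.1 h2.le]
    rfl
  | append_singleton w i ih =>
    have hu := (h.isNode w).mem_block.1
    have hs := (h.isNode (w ++ [i])).mem_block.1
    have h1 := isIteratedDoubling_J hs (J_eq_of_le hs hu (h.le w i)) w ih
    rw [J_J_of_le hs hu (h.le w i)] at h1
    exact isIteratedDoubling_append_singleton h1 (h.isDoubling w i)

/-- Since λ(w1) > λ(w), g annihilates u_{w1}; hence J_g(c_{w0}) = 2J_g(c_w). As λ(w0) = λ(w), the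
argument repeats at w0. -/
theorem exists_two_pow_nsmul (hs : cb.IsSpectral) (h : cb.IsTree a u c) {g : E} (hg : g ∈ cb.P)
    (m : ℕ) (w : List Bool) (hgw : cb.Avoids a g (binVal w)) :
    ∃ b, 2 ^ m • emb (cb.J g (c w)) = emb b := by
  induction m generalizing w with
  | zero => exact ⟨_, by rw [pow_zero, one_smul]⟩
  | succ m ih =>
    have hb := hs.bComparability.bProperty
    have h0 := h.isNode w
    have h1 := h.isNode (w ++ [false])
    have h2 : cb.J g (u (w ++ [true])) = 0 := by
      refine hgw _ (h.isNode _).mem_block _ (h.doubles _) ?_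
      rw [binVal_eq, binVal_eq, binK_append_singleton, List.length_append, List.length_singleton,
        pow_succ, div_lt_div_iff₀ (by positivity) (by positivity)]
      push_cast [Bool.toNat_true]
      have : (0 : ℚ) < 2 ^ w.length := by positivity
      nlinarith
    have h3 : ((binVal (w ++ [false]) : Set.Icc (0 : ℚ) 1) : ℚ) = binVal w := by
      rw [binVal_eq, binVal_eq, binK_append_singleton, List.length_append, List.length_singleton,
        pow_succ, Bool.toNat_false, add_zero, Nat.cast_mul, mul_comm, Nat.cast_ofNat]
      exact mul_div_mul_right _ _ two_ne_zero
    have h4 := J_add_J h1.mem_block.1 h0.mem_block.1 (h.add_eq w)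
      (hb.mem_commutant h0.mem_doubleCommutant h1.mem_block)
    rw [J_eq_self h0.mem_block.1 h0.cover.le] at h4
    have h5 := J_add hg h4
    rw [J_eq_zero_of_le hg (J_le (h.isNode _).mem_block.1 _) h2, emb_zero, add_zero] at h5
    obtain ⟨b, hb'⟩ := ih (w ++ [false]) (by rwa [h3])
    refine ⟨b, ?_⟩
    rw [← J_add hg (oplus_eq_some_iff.1 (h.isDoubling w false).1), h5] at hb'
    rw [← hb', pow_succ, mul_smul, two_smul]

theorem J_eq_zero_of_avoids (hs : cb.IsSpectral) (harch : IsArchimedean E)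
    (h : cb.IsTree a u c) {g : E} (hg : g ∈ cb.P) {w : List Bool}
    (hgw : cb.Avoids a g (binVal w)) : cb.J g (u w) = 0 := by
  rw [← (h.isNode w).cover.J_eq_zero_iff hg]
  refine harch.eq_zero fun n => ?_
  obtain ⟨b, hb⟩ := h.exists_two_pow_nsmul hs hg n w hgw
  exact exists_nsmul_of_le Nat.lt_two_pow_self.le hb

end IsTree

/-- `(a°)' ⊕ ⨁ {u_v : l(v) = n, k(v) < k}`. -/
noncomputable def partialSum (u : List Bool → E) (n k : ℕ) : PSum E :=
  emb (ortho (u [])) + ∑ j ∈ Finset.range k, emb (u (binStr n j))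

theorem partialSum_succ (u : List Bool → E) (n k : ℕ) :
    partialSum u n (k + 1) = partialSum u n k + emb (u (binStr n k)) := by
  rw [partialSum, partialSum, Finset.sum_range_succ, add_assoc]

theorem partialSum_zero (u : List Bool → E) (n : ℕ) :
    partialSum u n 0 = emb (ortho (u [])) := by
  rw [partialSum, Finset.sum_range_zero, add_zero]

theorem osum_eq_partialSum (u : List Bool → E) (w : List Bool) :
    osum (ortho (u []) ::
        ((binStrings (w.length + 1)).filter
          (fun v => binK v ≤ binK (w ++ [false]))).map u) =
      partialSum u (w.length + 1) (2 * binK w + 1) := by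
  rw [osum_eq, List.map_cons, List.sum_cons, List.map_map, sum_filter_binStrings, partialSum,
    binK_append_singleton, Bool.toNat_false, add_zero]
  · rfl
  · have := binK_lt (w ++ [false])
    rwa [List.length_append, List.length_singleton] at this

namespace IsTree

variable {u c : List Bool → E}

theorem partialSum_two_mul (h : cb.IsTree a u c) (n k : ℕ) :
    partialSum u (n + 1) (2 * k) = partialSum u n k := by
  induction k with
  | zero => rw [mul_zero, partialSum_zero, partialSum_zero]
  | succ k ih =>
    rw [mul_add, mul_one, partialSum_succ u (n + 1) (2 * k + 1), partialSum_succ, ih,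
      partialSum_succ, binStr_two_mul, binStr_two_mul_add_one, ← h.add_eq (binStr n k), add_assoc]

/-- Refinement leaves the total unchanged; that it is defined makes every shorter partial sum
defined. -/
theorem partialSum_two_pow (h : cb.IsTree a u c) (n : ℕ) : partialSum u n (2 ^ n) = emb 1 := by
  induction n with
  | zero => rw [pow_zero, ← zero_add 1, partialSum_succ, partialSum_zero, binStr, add_comm, emb_add_ortho]
  | succ n ih => rw [pow_succ, mul_comm, h.partialSum_two_mul, ih]

theorem exists_partialSum (h : cb.IsTree a u c) {n k : ℕ} (hk : k ≤ 2 ^ n) :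
    ∃ p, partialSum u n k = emb p := by
  induction hk using Nat.decreasingInduction with
  | self => exact ⟨1, h.partialSum_two_pow n⟩
  | of_succ k _ ih =>
    obtain ⟨p, hp⟩ := ih
    rw [partialSum_succ] at hp
    exact exists_emb_left hp

theorem partialSum_mem_block (h : cb.IsTree a u c) {n k : ℕ} {p : E}
    (hp : partialSum u n k = emb p) : p ∈ cb.block a := by
  induction k generalizing p with
  | zero =>
    rw [partialSum_zero] at hp
    rw [← emb_injective hp]
    exact block_ortho (h.isNode []).mem_block
  | succ k ih =>
    rw [partialSum_succ] at hp
    obtain ⟨q, hq⟩ := exists_emb_left hp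
    rw [hq] at hp
    exact block_add (ih hq) (h.isNode _).mem_block hp

theorem J_ortho_nil (h : cb.IsTree a u c) : cb.J (ortho (u [])) a = 0 :=
  (J_ortho_eq_zero_iff (h.isNode []).mem_block.1).2 h.isSplittingFamily.u_nil.le

/-- A property of projections that is preserved by sums holds for a partial sum if it holds for
its terms. -/
theorem partialSum_induction (Z : E → Prop)
    (hadd : ∀ p q r, emb p + emb q = emb r → p ∈ cb.block a → q ∈ cb.block a → Z p → Z q → Z r)
    (h : cb.IsTree a u c) {n k : ℕ} (hk : k ≤ 2 ^ n) (h0 : Z (ortho (u [])))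
    (hu : ∀ w : List Bool, ((binValSucc w : Set.Icc (0 : ℚ) 1) : ℚ) ≤ k / 2 ^ n → Z (u w))
    {p : E} (hp : partialSum u n k = emb p) : Z p := by
  have key : ∀ j ≤ k, ∀ p, partialSum u n j = emb p → Z p := by
    intro j
    induction j with
    | zero =>
      intro _ p hp
      rw [partialSum_zero] at hp
      rwa [← emb_injective hp]
    | succ j ih =>
      intro hj p hp
      rw [partialSum_succ] at hp
      obtain ⟨q, hq⟩ := exists_emb_left hp
      rw [hq] at hp
      refine hadd _ _ _ hp (h.partialSum_mem_block hq) (h.isNode _).mem_block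
        (ih (by omega) q hq) (hu _ ?_)
      rw [binValSucc_eq, length_binStr, binK_binStr (by omega)]
      gcongr
      exact_mod_cast hj
  exact key k le_rfl p hp

/-- The summands are pieces ending by k/2^n, so the sum avoids k/2^n. Conversely, a projection
avoiding k/2^n is orthogonal to each u_v with λ(v) ≥ k/2^n, and these can be removed one by one from
the total 1. -/
theorem isCut (hs : cb.IsSpectral) (harch : IsArchimedean E) (h : cb.IsTree a u c) {n k : ℕ}
    (hk : k ≤ 2 ^ n) {p : E} (hp : partialSum u n k = emb p) :
    cb.IsCut a ((k : ℚ) / 2 ^ n) p where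
  mem_block := h.partialSum_mem_block hp
  avoids := by
    have hb := hs.bComparability.bProperty
    refine h.partialSum_induction (fun p => cb.Avoids a p ((k : ℚ) / 2 ^ n))
      (fun p q r hr hp hq h1 h2 => h1.add hp.1 hq.1 hr h2) hk ?_ ?_ hp
    · exact avoids_of_J_eq_zero hb (block_ortho (h.isNode []).mem_block) h.J_ortho_nil
        (by positivity)
    · intro v hv r hr w hw hlt
      exact (h.doubles v).J_eq_zero_of_lt hw (h.isNode v).mem_block.1 hr.1
        (hb.mem_commutant (h.isNode v).mem_block.2 hr) (hv.trans_lt hlt)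
  le g hg hgl := by
    have key : ∀ j ≤ 2 ^ n, k ≤ j → ∀ p, partialSum u n j = emb p → g ≤ p := by
      intro j hj
      induction hj using Nat.decreasingInduction with
      | self =>
        intro _ p hp
        rw [h.partialSum_two_pow] at hp
        rw [← emb_injective hp]
        exact ea_le_one g
      | of_succ j hj ih =>
        intro hkj p hp
        obtain ⟨q, hq⟩ := h.exists_partialSum hj
        have h1 := ih (by omega) q hq
        rw [partialSum_succ, hp, add_comm] at hq
        have h2 := ortho_add_of_add hq
        have h3 : cb.J g (u (binStr n j)) = 0 := by
          refine h.J_eq_zero_of_avoids hs harch hg (hgl.mono ?_)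
          rw [binVal_eq, length_binStr, binK_binStr (by omega)]
          gcongr
        have h4 := J_eq_zero_of_add hg h2 ((J_eq_zero_iff hg).2 (ortho_anti h1)) h3
        exact ortho_le_ortho.1 ((J_eq_zero_iff hg).1 h4)
    exact key k hk le_rfl p hp

end IsTree

end CompressionBase

/-! ### Cuts and the spectral resolutions. -/

theorem exists_dyadic_between {x y : Set.Icc (0 : ℚ) 1} (h : x < y) :
    ∃ m : Set.Icc (0 : ℚ) 1, IsDyadic m ∧ x < m ∧ m < y := by
  have hxy : (x : ℚ) < y := h
  obtain ⟨n, hn⟩ := exists_one_div_two_pow_lt (sub_pos.2 hxy)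
  have hpos : (0 : ℚ) < 2 ^ n := by positivity
  have h1 : (x : ℚ) < ((⌊(x : ℚ) * 2 ^ n⌋₊ + 1 : ℕ) : ℚ) / 2 ^ n := by
    rw [lt_div_iff₀ hpos]
    push_cast
    exact Nat.lt_floor_add_one _
  have h2 : ((⌊(x : ℚ) * 2 ^ n⌋₊ + 1 : ℕ) : ℚ) / 2 ^ n < y := by
    have h3 : ((⌊(x : ℚ) * 2 ^ n⌋₊ + 1 : ℕ) : ℚ) / 2 ^ n ≤ x + 1 / 2 ^ n := by
      push_cast
      rw [add_div]
      gcongr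
      rw [div_le_iff₀ hpos]
      exact Nat.floor_le (mul_nonneg x.2.1 hpos.le)
    linarith
  exact ⟨⟨_, x.2.1.trans h1.le, h2.le.trans y.2.2⟩, ⟨_, n, rfl⟩, h1, h2⟩

theorem IsDyadic.exists_le {m : Set.Icc (0 : ℚ) 1} (h : IsDyadic m) :
    ∃ k n : ℕ, k ≤ 2 ^ n ∧ (m : ℚ) = k / 2 ^ n := by
  obtain ⟨k, n, hm⟩ := h
  refine ⟨k, n, ?_, hm⟩
  have h1 := m.2.2
  rw [hm, div_le_one (by positivity)] at h1
  exact_mod_cast h1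

namespace CompressionBase

open EffectAlgebra

variable {E : Type v} [EffectAlgebra E] {cb : CompressionBase E} {a : E}

/-- The cover of a lower bound still lies below every R m. It avoids l because any λ(w) > l leaves
room for a dyadic m in between. T serves for the dyadics and for all rationals alike. -/
theorem isGLB_of_isCut (hcov : cb.ProjectionCoverProperty) {R : Set.Icc (0 : ℚ) 1 → E}
    (hR : ∀ l : Set.Icc (0 : ℚ) 1, cb.IsCut a l (R l))
    {T : Set (Set.Icc (0 : ℚ) 1)} (hT : ∀ m, IsDyadic m → m ∈ T)
    (l : Set.Icc (0 : ℚ) 1) : IsGLB {x | ∃ m ∈ T, l < m ∧ x = R m} (R l) := by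
  constructor
  · rintro x ⟨m, _, hlm, rfl⟩
    exact (hR l).le_of_le (hR m) hlm.le
  · intro h hh
    obtain ⟨g, hg⟩ := hcov h
    refine hg.le.trans ((hR l).le g hg.1 fun r hr w hw hlw => ?_)
    obtain ⟨m, hm, hlm, hmw⟩ := exists_dyadic_between (show l < binVal w from hlw)
    have hRm := hR m
    have h1 : g ≤ R m := (hg.2 _ hRm.mem_block.1).1 (hh ⟨m, hT m hm, hlm, rfl⟩)
    exact hRm.avoids.of_le hg.1 hRm.mem_block.1 h1 r hr w hw hmw

theorem IsTree.isBinarySpectralResolution_iff (hs : cb.IsSpectral) (harch : IsArchimedean E)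
    {u c : List Bool → E} (h : cb.IsTree a u c) (q : {μ : Set.Icc (0 : ℚ) 1 // IsDyadic μ} → E) :
    cb.IsBinarySpectralResolution a q ↔ ∀ μ, cb.IsCut a μ.1 (q μ) := by
  constructor
  · rintro ⟨u', c', h', h0, h1, hq⟩
    obtain rfl := h.unique hs h'
    have key : ∀ n k : ℕ, k ≤ 2 ^ n → ∀ μ, ((μ.1 : Set.Icc (0 : ℚ) 1) : ℚ) = k / 2 ^ n →
        partialSum u' n k = emb (q μ) := by
      intro n
      induction n with
      | zero =>
        intro k hk μ hμ
        rw [pow_zero] at hk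
        rw [pow_zero, div_one] at hμ
        interval_cases k
        · rw [partialSum_zero, h0 μ (Subtype.ext (by rw [hμ]; rfl))]
        · rw [h1 μ (Subtype.ext (by rw [hμ]; rfl))]
          exact h.partialSum_two_pow 0
      | succ n ih =>
        intro k hk μ hμ
        rw [pow_succ] at hk
        -- The definition prescribes values at odd numerators only; even ones descend to the
        -- previous level.
        rcases Nat.even_or_odd' k with ⟨j, rfl | rfl⟩
        · rw [h.partialSum_two_mul]
          refine ih j (by omega) μ ?_
          rw [hμ, pow_succ, Nat.cast_mul, mul_comm, Nat.cast_ofNat]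
          exact mul_div_mul_right _ _ two_ne_zero
        · have h2 := binK_binStr (n := n) (k := j) (by omega)
          have h3 := hq (binStr n j) μ (Subtype.ext (by
            rw [hμ, binVal_eq, binK_append_singleton, h2, List.length_append, length_binStr,
              Bool.toNat_true, List.length_singleton]))
          rw [osum_eq_partialSum, length_binStr, h2] at h3
          exact h3
    intro μ
    obtain ⟨k, n, hk, hμ⟩ := μ.2.exists_le
    rw [hμ]
    exact h.isCut hs harch hk (key n k hk μ hμ)
  · intro hq
    have key : ∀ n k : ℕ, k ≤ 2 ^ n → ∀ μ, ((μ.1 : Set.Icc (0 : ℚ) 1) : ℚ) = k / 2 ^ n →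
        partialSum u n k = emb (q μ) := by
      intro n k hk μ hμ
      obtain ⟨p, hp⟩ := h.exists_partialSum hk
      have h1 := hq μ
      rw [hμ] at h1
      rw [hp, h1.unique (h.isCut hs harch hk hp)]
    refine ⟨u, c, h.isSplittingFamily, fun μ hμ => ?_, fun μ hμ => ?_, fun w μ hμ => ?_⟩
    · have h1 := key 0 0 (by simp) μ (by rw [hμ]; simp)
      rw [partialSum_zero] at h1
      exact (emb_injective h1).symm
    · have h1 := key 0 (2 ^ 0) le_rfl μ (by rw [hμ]; simp)
      rw [h.partialSum_two_pow] at h1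
      exact (emb_injective h1).symm
    · have h1 := binK_lt w
      rw [osum_eq_partialSum]
      refine key (w.length + 1) (2 * binK w + 1) (by rw [pow_succ]; omega) μ ?_
      rw [hμ, binVal_eq, binK_append_singleton, List.length_append, List.length_singleton,
        Bool.toNat_true]

theorem IsTree.isRationalSpectralResolution_iff (hs : cb.IsSpectral) (harch : IsArchimedean E)
    {u c : List Bool → E} (h : cb.IsTree a u c) {R : Set.Icc (0 : ℚ) 1 → E}
    (hR : ∀ l : Set.Icc (0 : ℚ) 1, cb.IsCut a l (R l)) (p : Set.Icc (0 : ℚ) 1 → E) :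
    cb.IsRationalSpectralResolution a p ↔ p = R := by
  have hset : ∀ (q : {μ : Set.Icc (0 : ℚ) 1 // IsDyadic μ} → E), (∀ μ, q μ = R μ.1) →
      ∀ l : Set.Icc (0 : ℚ) 1, {x | ∃ μ, l < μ.1 ∧ x = q μ} =
        {x | ∃ m ∈ {m | IsDyadic m}, l < m ∧ x = R m} := by
    intro q hq l
    ext x
    constructor
    · rintro ⟨μ, h1, rfl⟩
      exact ⟨μ.1, μ.2, h1, hq μ⟩
    · rintro ⟨m, h1, h2, rfl⟩
      exact ⟨⟨m, h1⟩, h2, (hq ⟨m, h1⟩).symm⟩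
  have hglb := isGLB_of_isCut hs.projectionCoverProperty hR (T := {m | IsDyadic m})
    fun _ hm => hm
  constructor
  · rintro ⟨q, hq, hp⟩
    rw [h.isBinarySpectralResolution_iff hs harch] at hq
    have h1 := hset q fun μ => (hq μ).unique (hR μ.1)
    funext l
    have h2 := hp l
    rw [h1 l] at h2
    exact h2.unique (hglb l)
  · rintro rfl
    refine ⟨fun μ => p μ.1, (h.isBinarySpectralResolution_iff hs harch _).2 fun μ => hR μ.1,
      fun l => ?_⟩
    rw [hset _ (fun _ => rfl) l]
    exact hglb l

theorem IsTree.spectralConditions (hs : cb.IsSpectral) (harch : IsArchimedean E)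
    {u c : List Bool → E} (h : cb.IsTree a u c) {R : Set.Icc (0 : ℚ) 1 → E}
    (hR : ∀ l : Set.Icc (0 : ℚ) 1, cb.IsCut a l (R l)) : cb.SpectralConditions a R where
  mem_PC l := hs.bComparability.bProperty.mem_PC (hR l).mem_block
  zero_le := by
    have h1 := h.isCut hs harch (Nat.zero_le (2 ^ 0)) (partialSum_zero u 0)
    rw [Nat.cast_zero, zero_div] at h1
    rw [(hR 0).unique h1]
    exact ortho_anti h.isSplittingFamily.u_nil.le
  one_eq := (hR 1).unique isCut_one
  mono l m hlm := (hR l).le_of_le (hR m) hlm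
  right_continuous l := by
    have h1 := isGLB_of_isCut hs.projectionCoverProperty hR (T := Set.univ)
      (fun _ _ => Set.mem_univ _) l
    simpa only [Set.mem_univ, true_and] using h1
  doubling w := by
    have hw := (h.isNode w).mem_block.1
    refine ⟨u w, hw, ?_, h.doubles w⟩
    have hlt := binK_lt w
    obtain ⟨p, hp⟩ := h.exists_partialSum hlt.le
    obtain ⟨q, hq⟩ := h.exists_partialSum (Nat.succ_le_of_lt hlt)
    have h1 := h.isCut hs harch hlt.le hp
    have h2 := h.isCut hs harch (Nat.succ_le_of_lt hlt) hq
    rw [partialSum_succ, hp, binStr_binK] at hq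
    rw [Nat.succ_eq_add_one, Nat.cast_add, Nat.cast_one] at h2
    rw [(hR (binVal w)).unique h1, (hR (binValSucc w)).unique h2, Set.pair_comm]
    exact isGLB_of_add h1.mem_block.1 hq

/-! ### Uniqueness from the four conditions. -/

namespace SpectralConditions

variable {p : Set.Icc (0 : ℚ) 1 → E}

/-- By monotonicity the infimum in condition 4 is the difference of the two values, so sums over
consecutive strings telescope. -/
theorem exists_add (h : cb.SpectralConditions a p) (w : List Bool) :
    ∃ u, cb.Doubles a u w ∧ u ∈ cb.P ∧ emb (p (binVal w)) + emb u = emb (p (binValSucc w)) := by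
  obtain ⟨u, huP, hu, hd⟩ := h.doubling w
  have hle : binVal w ≤ binValSucc w := by
    rw [← Subtype.coe_le_coe, binValSucc_eq_add]
    have : (0 : ℚ) ≤ 1 / 2 ^ w.length := by positivity
    linarith
  obtain ⟨t, ht⟩ := le_iff_emb.1 (h.mono _ _ hle)
  rw [Set.pair_comm] at hu
  obtain rfl := hu.unique (isGLB_of_add (h.mem_PC _).1 ht)
  exact ⟨u, hd, huP, ht⟩

/-- The p l are only known to lie in PC(a), possibly outside the block. This is why `Avoids` tests a
projection against block elements alone. -/
theorem mem_commutant (h : cb.SpectralConditions a p) {r : E} (hr : r ∈ cb.block a)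
    (l : Set.Icc (0 : ℚ) 1) : p l ∈ cb.commutant r :=
  commutant_symm hr.1 (h.mem_PC l).1 (hr.2 _ (h.mem_PC l))

theorem exists_add_of_mem_block (h : cb.SpectralConditions a p) {r : E} (hr : r ∈ cb.block a)
    {n j : ℕ} (hj : j < 2 ^ n) {m : Set.Icc (0 : ℚ) 1}
    (hm : (m : ℚ) = ((j + 1 : ℕ) : ℚ) / 2 ^ n) :
    ∃ w : List Bool, (binVal w : ℚ) = j / 2 ^ n ∧ binValSucc w = m ∧ ∃ u ∈ cb.P,
      cb.Doubles a u w ∧ u ∈ cb.commutant r ∧ emb (p (binVal w)) + emb u = emb (p m) := by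
  have h1 := binK_binStr hj
  have h2 : binValSucc (binStr n j) = m := Subtype.ext (by
    rw [binValSucc_eq, h1, length_binStr, hm, Nat.cast_add, Nat.cast_one])
  obtain ⟨u, hd, huP, hu⟩ := h.exists_add (binStr n j)
  refine ⟨binStr n j, by rw [binVal_eq, h1, length_binStr], h2, u, huP, hd, ?_, h2 ▸ hu⟩
  exact commutant_sub hr.1 (h.mem_commutant hr _) (h.mem_commutant hr _) hu

theorem avoids (h : cb.SpectralConditions a p) {m : Set.Icc (0 : ℚ) 1} (hm : IsDyadic m) :
    cb.Avoids a (p m) m := by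
  obtain ⟨k, n, hk, hmk⟩ := hm.exists_le
  intro r hr w hw hlw
  rw [J_eq_zero_comm (h.mem_PC m).1 hr.1]
  have key : ∀ j ≤ k, ∀ l : Set.Icc (0 : ℚ) 1, (l : ℚ) = j / 2 ^ n → cb.J r (p l) = 0 := by
    intro j
    induction j with
    | zero =>
      intro _ l hl
      obtain rfl : l = 0 := Subtype.ext (by rw [hl, Nat.cast_zero, zero_div]; rfl)
      obtain ⟨i, hi⟩ := exists_one_div_two_pow_lt (m.2.1.trans_lt hlw)
      have hp := (h.mem_PC 0).1
      -- As a vanishes on p_0, this projection is a piece over [0, 2^{-i}] for every i, in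
      -- particular over one ending before λ(w).
      have h0 : cb.J (p 0) a = 0 := (J_eq_zero_iff hp).2 (le_ortho_comm.1 h.zero_le)
      rw [J_eq_zero_comm hr.1 hp]
      refine (doubles_replicate_false h0 i).J_eq_zero_of_lt hw hp hr.1 (h.mem_commutant hr 0) ?_
      rwa [binValSucc_eq, binK_replicate_false, Nat.cast_zero, zero_add, List.length_replicate]
    | succ j ih =>
      intro hj l hl
      obtain ⟨v, hv, hvl, u, huP, hd, hur, hsum⟩ :=
        h.exists_add_of_mem_block hr (show j < 2 ^ n by omega) hl
      refine J_eq_zero_of_add hr.1 hsum (ih (by omega) _ hv) ?_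
      rw [J_eq_zero_comm hr.1 huP]
      refine hd.J_eq_zero_of_lt hw huP hr.1 hur ?_
      rw [hvl]
      refine lt_of_le_of_lt ?_ hlw
      rw [hl, hmk]
      gcongr
  exact key k le_rfl m hmk

/-- Descending from p_1 = 1, the complement of p_m is a sum of pieces starting at or after m, all
separated from the interval of v. -/
theorem J_ortho_eq_zero (h : cb.SpectralConditions a p) {m : Set.Icc (0 : ℚ) 1} (hm : IsDyadic m)
    {r : E} (hr : r ∈ cb.block a) {v : List Bool} (hv : cb.Doubles a r v)
    (hvm : binValSucc v < m) : cb.J (ortho (p m)) r = 0 := by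
  obtain ⟨k, n, hk, hmk⟩ := hm.exists_le
  rw [J_eq_zero_comm (cb.ortho_mem (h.mem_PC m).1) hr.1]
  have key : ∀ j ≤ 2 ^ n, k ≤ j → ∀ l : Set.Icc (0 : ℚ) 1, (l : ℚ) = j / 2 ^ n →
      cb.J r (ortho (p l)) = 0 := by
    intro j hj
    induction hj using Nat.decreasingInduction with
    | self =>
      intro _ l hl
      obtain rfl : l = 1 := Subtype.ext (by
        rw [hl, Nat.cast_pow, Nat.cast_ofNat, div_self (by positivity)]; rfl)
      rw [h.one_eq, ortho_one, J_zero hr.1]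
    | of_succ j hj ih =>
      intro hkj l hl
      have hj' : ((j + 1 : ℕ) : ℚ) / 2 ^ n ∈ Set.Icc (0 : ℚ) 1 := by
        refine ⟨by positivity, ?_⟩
        rw [div_le_one (by positivity)]
        exact_mod_cast hj
      obtain ⟨w, hw, _, u, huP, hd, hur, hsum⟩ :=
        h.exists_add_of_mem_block hr hj (m := ⟨_, hj'⟩) rfl
      obtain rfl : binVal w = l := Subtype.ext (by rw [hw, hl])
      refine J_eq_zero_of_add hr.1 (ortho_add_of_add ((add_comm _ _).trans hsum))
        (ih (by omega) _ rfl) ?_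
      refine hv.J_eq_zero_of_lt hd hr.1 huP (commutant_symm huP hr.1 hur) ?_
      refine lt_of_lt_of_le (show ((binValSucc v : Set.Icc (0 : ℚ) 1) : ℚ) < m from hvm) ?_
      rw [hl, hmk]
      gcongr
  exact key k hk le_rfl m hmk

theorem eq_of_isCut (hs : cb.IsSpectral) (harch : IsArchimedean E)
    (hp : cb.SpectralConditions a p) {u c : List Bool → E} (h : cb.IsTree a u c)
    {R : Set.Icc (0 : ℚ) 1 → E} (hR : ∀ l : Set.Icc (0 : ℚ) 1, cb.IsCut a l (R l)) : p = R := by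
  have h1 : ∀ m, IsDyadic m → p m ≤ R m := fun m hm =>
    (hR m).le _ (hp.mem_PC m).1 (hp.avoids hm)
  have h2 : ∀ l m, IsDyadic l → IsDyadic m → l < m → R l ≤ p m := by
    intro l m hl hm hlm
    obtain ⟨k, n, hk, hlk⟩ := hl.exists_le
    obtain ⟨q, hq⟩ := h.exists_partialSum hk
    have hcut := hR l
    rw [hlk] at hcut
    rw [hcut.unique (h.isCut hs harch hk hq)]
    have hpm := (hp.mem_PC m).1
    rw [← J_ortho_eq_zero_iff hpm]
    refine h.partialSum_induction (fun q => cb.J (ortho (p m)) q = 0)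
      (fun _ _ _ hr _ _ => J_eq_zero_of_add (cb.ortho_mem hpm) hr) hk ?_ ?_ hq
    · obtain ⟨i, hi⟩ := exists_one_div_two_pow_lt (lt_of_le_of_lt l.2.1
        (show (l : ℚ) < m from hlm))
      refine hp.J_ortho_eq_zero hm (block_ortho (h.isNode []).mem_block)
        (doubles_replicate_false h.J_ortho_nil i) ?_
      rw [← Subtype.coe_lt_coe, binValSucc_eq, binK_replicate_false, List.length_replicate,
        Nat.cast_zero, zero_add]
      exact hi
    · intro v hv
      refine hp.J_ortho_eq_zero hm (h.isNode v).mem_block (h.doubles v) ?_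
      rw [← hlk] at hv
      exact lt_of_le_of_lt hv hlm
  have hglb := isGLB_of_isCut hs.projectionCoverProperty hR (T := {m | IsDyadic m})
    fun _ hm => hm
  funext l
  apply le_antisymm
  · refine (hglb l).2 ?_
    rintro x ⟨m, hm, hlm, rfl⟩
    exact (hp.mono l m hlm.le).trans (h1 m hm)
  · refine (hp.right_continuous l).2 ?_
    rintro x ⟨m, hlm, rfl⟩
    -- Two dyadic points are needed, since cuts are compared with p only across a strict gap.
    obtain ⟨m₁, hm₁, h3, h4⟩ := exists_dyadic_between hlm
    obtain ⟨m₂, hm₂, h5, h6⟩ := exists_dyadic_between h4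
    exact ((hR l).le_of_le (hR m₁) h3.le).trans
      ((h2 m₁ m₂ hm₁ hm₂ h5).trans (hp.mono _ _ h6.le))

end SpectralConditions

end CompressionBase

theorem mainTheorem3 {E : Type*} [EffectAlgebra E] (cb : CompressionBase E)
    (hspec : cb.IsSpectral) (harch : EffectAlgebra.IsArchimedean E) (a : E) :
    (∃! p : Set.Icc (0 : ℚ) 1 → E, cb.IsRationalSpectralResolution a p) ∧
      ∀ p : Set.Icc (0 : ℚ) 1 → E,
        cb.IsRationalSpectralResolution a p ↔ cb.SpectralConditions a p := by
  obtain ⟨u, c, h⟩ := CompressionBase.exists_isTree hspec a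
  choose R hR using CompressionBase.exists_isCut hspec harch a
  have hiff := h.isRationalSpectralResolution_iff hspec harch hR
  refine ⟨⟨R, (hiff R).2 rfl, fun p hp => (hiff p).1 hp⟩, fun p => ?_⟩
  rw [hiff]
  constructor
  · rintro rfl
    exact h.spectralConditions hspec harch hR
  · exact fun hp => hp.eq_of_isCut hspec harch h hR
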